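/- Let $\mathbb{N}=\{1,2,\ldots\}$ and let $\mathbb{V}=\mathbb{N}^\star$ be the set of finite words over $\mathbb{N}$; for $u=(u_1,\ldots,u_k)\in\mathbb{V}$ write $|u|=k$, $|u|_1=u_1+\cdots+u_k$, and $ui=(u_1,\ldots,u_k,i)$. Random recursive trees $Y_1,Y_2,\ldots$ are grown by starting with the single node $1$ (the root) and joining, for each $n\ge 1$, the new node $n+1$ to a node of $Y_n$ chosen uniformly at random, independently of the previous choices. Each node $j$ gets a word $u(j)\in\mathbb{V}$: $u(1)=\emptyset$, and for $j\ge 2$ with direct ancestor $i$, $u(j)=u(i)m$, where $m$ is the number of nodes $l\in\{2,\ldots,j\}$ that have the same direct ancestor as $j$. Let $X_n=\{u(1),\ldots,u(n)\}$ (the Harris chain), and let $\#X_n(u)$ be the number of elements of $X_n$ with prefix $u$. Let $\bar{\mathbb{V}}$ be the set consisting of all finite words over $\mathbb{N}$, all infinite sequences over $\mathbb{N}$, and all sequences $(u_1,\ldots,u_k,\infty,\infty,\ldots)$ with $k\ge 0$ and $u_i\in\mathbb{N}$; for $u\in\mathbb{V}$ let $A_u\subset\bar{\mathbb{V}}$ be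 the set of elements with prefix $u$, and equip $\bar{\mathbb{V}}$ with the $\sigma$-field generated by the sets $A_u$. Then there is a random probability measure $X_\infty$ on $\bar{\mathbb{V}}$ such that, almost surely, $\frac1n\#X_n(u)\to X_\infty(A_u)$ for all $u\in\mathbb{V}$. Let $X_\infty$ be any such limit. Almost surely, for all $u\in\mathbb{V}$, $X_\infty(A_u)>0$ and $\rho(X_\infty,u)=(\rho_i(X_\infty,u))_{i\ge1}$, $\rho_i(X_\infty,u)=X_\infty(A_{ui})/X_\infty(A_u)$, is a probability sequence for which the series in $$C(s)=1+\sum_{i=1}^\infty s_i\log s_i,\qquad D(s)=-2+\sum_{i=1}^\infty i\,s_i$$ converge at $s=\rho(X_\infty,u)$. The series $$Y_\infty=\sum_{u\in\mathbb{V}}X_\infty(A_u)\,C(\rho(X_\infty,u)),\qquad Z_\infty=\sum_{u\in\mathbb{V}}X_\infty(A_u)\,D(\rho(X_\infty,u))$$ converge in the sense that the partial sums over $\{u:|u|_1\le k\}$ converge in $L^p$ as $k\to\infty$, for every $p>0$. Let $\mathrm{HPL}(x)=\sum_{u\in x}(|u|_1-|u|)$ be the horizontal total path length of a finite $x\subset\mathbb{V}$,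 and $H_n=\sum_{k=1}^n 1/k$. Then, as $n\to\infty$, $$\frac1n\,\mathrm{HPL}(X_n)-H_n+2\;\to\;Y_\infty+Z_\infty$$ almost surely and in $L^p$ for every $p>0$. Moreover, $E\,\mathrm{HPL}(X_n)=nH_n-2n+1$ for all $n\ge1$. -/

import Mathlib

open MeasureTheory ProbabilityTheory Filter Topology

namespace RRT

/-- Potential tree nodes: finite words over the positive integers.
Concatenation `u + v` of words is `u ++ v`, and `ui` is `u ++ [i]`. -/
abbrev Node : Type := List ℕ+

/-- `|u|₁`, the sum of the letters of `u`. The depth `|u|` is `u.length`. -/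
def norm1 (u : Node) : ℕ := (u.map (fun i : ℕ+ => (i : ℕ))).sum

/-! ### Recursive trees and Harris trees -/

/-- An infinite encoding sequence of nested recursive trees, with nodes numbered `0, 1, 2, …`
and root `0`: the direct ancestor of node `k + 1` is `e k ∈ {0, …, k}`.
The recursive tree with `n` nodes is given by the first `n - 1` entries. -/
abbrev Encoding : Type := (k : ℕ) → Fin (k + 1)

/-- The word of a node of the recursive tree. The root has the empty word; the word of `k + 1`
is the word of its direct ancestor followed by the birth rank of `k + 1` among the children of
this ancestor, that is, one plus the number of earlier nodes with the same ancestor. -/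
def word (e : Encoding) : ℕ → Node
  | 0 => []
  | k + 1 =>
      word e (e k : ℕ) ++
        [Nat.succPNat ((Finset.range k).filter (fun i => (e i : ℕ) = (e k : ℕ))).card]
  decreasing_by exact (e k).isLt

/-- The Harris tree with `n` nodes obtained from the recursive tree with `n` nodes encoded by
`e 0, …, e (n - 2)`. -/
def harrisTree (e : Encoding) (n : ℕ) : Finset Node := (Finset.range n).image (word e)

/-- `#x(u)`, the size of the subtree `x(u) = {v : u + v ∈ x}` of `x` rooted at `u`
(counted through `u + v`). -/
def subtreeSize (x : Finset Node) (u : Node) : ℕ := (x.filter (fun w => u <+: w)).card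

/-- The horizontal total path length `∑_{u ∈ x} (|u|₁ - |u|)`. -/
noncomputable def HPL (x : Finset Node) : ℝ := ∑ u ∈ x, ((norm1 u : ℝ) - (u.length : ℝ))

/-- The random choices of a random recursive tree chain: the direct ancestor of each new node is
uniform on the nodes of the current tree, independently of the earlier choices. -/
structure IsRRTProcess {Ω : Type*} [MeasurableSpace Ω] (e : (k : ℕ) → Ω → Fin (k + 1))
    (P : Measure Ω) : Prop where
  measurable : ∀ k, Measurable (e k)
  indep : iIndepFun e P
  uniform : ∀ k (i : Fin (k + 1)), P (e k ⁻¹' {i}) = 1 / ((k : ENNReal) + 1)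

/-- The Harris chain `X_n` associated with the random recursive tree chain. -/
def harrisChain {Ω : Type*} (e : (k : ℕ) → Ω → Fin (k + 1)) (n : ℕ) (ω : Ω) : Finset Node :=
  harrisTree (fun k => e k ω) n

/-! ### The boundary and the limit tree -/

/-- The completed set of nodes: the finite words, the infinite words, and the infinite
sequences `(u₁, …, u_k, ∞, ∞, …)`. -/
inductive NodeBar : Type
  | finite (u : Node)
  | infinite (s : ℕ → ℕ+)
  | escaping (u : Node)

/-- `u ≤ v`: the finite word `u` is a prefix of `v`. -/
def IsPrefixBar (u : Node) : NodeBar → Prop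
  | NodeBar.finite w => u <+: w
  | NodeBar.infinite s => ∀ (i : ℕ) (h : i < u.length), u[i] = s i
  | NodeBar.escaping w => u <+: w

/-- The set `A_u` of elements with prefix `u`. -/
def cyl (u : Node) : Set NodeBar := {v | IsPrefixBar u v}

instance : MeasurableSpace NodeBar := MeasurableSpace.generateFrom (Set.range cyl)

/-- `μ(A_u)`. -/
noncomputable def mass (μ : ProbabilityMeasure NodeBar) (u : Node) : ℝ :=
  (μ : Measure NodeBar).real (cyl u)

/-- The random probability measure `Xinf` is the almost sure limit of the trees `X n`
in the Doob-Martin topology: `#X_n(u) / n → Xinf(A_u)` for all nodes `u`. -/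
structure IsDoobMartinLimit {Ω : Type*} [MeasurableSpace Ω] (X : ℕ → Ω → Finset Node)
    (Xinf : Ω → ProbabilityMeasure NodeBar) (P : Measure Ω) : Prop where
  measurable : ∀ u, Measurable (fun ω => mass (Xinf ω) u)
  tendsto : ∀ᵐ ω ∂P, ∀ u,
    Tendsto (fun n : ℕ => (subtreeSize (X n ω) u : ℝ) / (n : ℝ)) atTop (𝓝 (mass (Xinf ω) u))

/-- `ρ_i(μ, u) = μ(A_{ui}) / μ(A_u)`. -/
noncomputable def rho (μ : ProbabilityMeasure NodeBar) (u : Node) (i : ℕ+) : ℝ :=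
  mass μ (u ++ [i]) / mass μ u

/-- `C(s) = 1 + ∑ s_i log s_i`. -/
noncomputable def C (s : ℕ+ → ℝ) : ℝ := 1 + ∑' i : ℕ+, s i * Real.log (s i)

/-- `D(s) = -2 + ∑ i s_i`. -/
noncomputable def D (s : ℕ+ → ℝ) : ℝ := -2 + ∑' i : ℕ+, (i : ℝ) * s i

/-- All quantities entering `C(ρ(μ,u))` and `D(ρ(μ,u))` make sense: `μ(A_u)` is positive,
`ρ(μ,u)` is a probability sequence, and the two series converge. -/
structure IsRegular (μ : ProbabilityMeasure NodeBar) : Prop where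
  mass_pos : ∀ u, 0 < mass μ u
  hasSum_rho : ∀ u, HasSum (rho μ u) 1
  summable_C : ∀ u, Summable (fun i : ℕ+ => rho μ u i * Real.log (rho μ u i))
  summable_D : ∀ u, Summable (fun i : ℕ+ => (i : ℝ) * rho μ u i)

/-! ### Series over all nodes -/

theorem finite_norm1_le (k : ℕ) : {u : Node | norm1 u ≤ k}.Finite := by
  induction k with
  | zero =>
    refine (Set.finite_singleton ([] : Node)).subset ?_
    intro u hu
    cases u with
    | nil => rfl
    | cons a t =>
      have ha := a.pos
      simp only [Set.mem_ofPred_eq, norm1, List.map_cons, List.sum_cons] at hu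
      omega
  | succ k ih =>
    have hs : (Set.Iic (⟨k + 1, Nat.succ_pos k⟩ : ℕ+)).Finite := Set.finite_Iic _
    refine ((Set.finite_singleton ([] : Node)).union
      (Set.Finite.image2 (fun (a : ℕ+) (t : Node) => a :: t) hs ih)).subset ?_
    intro u hu
    cases u with
    | nil => exact Or.inl rfl
    | cons a t =>
      have ha := a.pos
      simp only [Set.mem_ofPred_eq, norm1, List.map_cons, List.sum_cons] at hu
      refine Or.inr ⟨a, ?_, t, ?_, rfl⟩
      · change (a : ℕ) ≤ k + 1
        omega
      · simp only [Set.mem_ofPred_eq, norm1]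
        omega

/-- The finite set of all nodes `u` with `|u|₁ ≤ k`. -/
noncomputable def nodesUpTo (k : ℕ) : Finset Node := (finite_norm1_le k).toFinset

/-- Convergence in `L^p`, `0 < p < ∞`, of random variables that are themselves in `L^p`. -/
structure TendstoInLp {Ω : Type*} [MeasurableSpace Ω] (f : ℕ → Ω → ℝ) (g : Ω → ℝ) (p : ℝ)
    (P : Measure Ω) : Prop where
  memLp : ∀ n, MemLp (f n) (ENNReal.ofReal p) P
  memLp_limit : MemLp g (ENNReal.ofReal p) P
  tendsto : Tendsto (fun n => eLpNorm (f n - g) (ENNReal.ofReal p) P) atTop (𝓝 0)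

/-- `S = ∑_u Xinf(A_u) F(ρ(Xinf, u))` in the sense that the partial sums over the nodes with
`|u|₁ ≤ k` converge to `S` in `L^p`, as `k → ∞`, for all `p > 0`. -/
def IsNodeSeries {Ω : Type*} [MeasurableSpace Ω] (F : (ℕ+ → ℝ) → ℝ)
    (Xinf : Ω → ProbabilityMeasure NodeBar) (S : Ω → ℝ) (P : Measure Ω) : Prop :=
  ∀ p : ℝ, 0 < p →
    TendstoInLp (fun k ω => ∑ u ∈ nodesUpTo k, mass (Xinf ω) u * F (rho (Xinf ω) u)) S p P

end RRT

namespace RRT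

/-! ### Combinatorics of recursive trees -/

/-! Index trees by the number `n` of choices made, so that there are `n + 1` nodes. Call `Q` an urn
functional (`IsUrn`) if it is a sum of values `q n j` over the nodes and choosing parent `j` raises
it by exactly `q n j`. A uniform choice then multiplies the conditional mean by `(n + 2) / (n + 1)`,
so `Q n / (n + 1)` is a martingale. Since `|u|₁ - |u| = |u| + (|u|₁ - 2|u|)`, the horizontal path
length splits, after centring, into two such functionals, `pathSum 0` and `widthSum 0`
(`HPL_harrisTree`). Both vanish on the one-node tree, which gives the mean.

The values `q n j` are bounded by a height plus a harmonic number. The heights are those of the open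
slots of a growing binary tree, and their exponential moment to base `3 / 2` is computed exactly.
Hence all moments of the martingale increments decay fast enough that `E |M_n - M_m| ^ p ≤ η m` for
even `p ≥ 4`, with `η m → 0` depending only on `p` and not on the functional
(`IsUrn.exists_moment_bound`). This uniformity carries the proof.

Cut the tree at the words where the norm first reaches `k`, and apply the same functionals to the
subtrees hanging there. The results `pathSum k` and `widthSum k` are again urn functionals, and they
vanish for `n < k` because the word of node `j` has norm at most `j`. So the uniform bound makes the
normalized cut functional at level `k + 1` small in `L^p`, uniformly in `n`. By telescoping along
prefixes, the full functional minus the cut one is a finite sum of tolls over `|u|₁ ≤ k`, and the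
normalized tolls tend almost surely to `X(A_u) C(ρ)` and `X(A_u) D(ρ)`. Thus the martingale limit is
the limit of the partial sums (`exists_limit_series`), without any absolute convergence over all
nodes.

The toll limits are sums over infinitely many children, so dominated convergence is needed. A
geometrically weighted submartingale (`childSum`) bounds the share of child `i` by a multiple of `(2
/ 3) ^ i`, and a nonnegative harmonic potential keeps the limiting masses positive; together they
give `ae_isGood`. The limit measure itself is built by representing words by nested intervals in
`[0, 1)` and pushing Lebesgue measure forward (`IsFlow.exists_mass_eq`). -/

theorem norm1_append (u v : Node) : norm1 (u ++ v) = norm1 u + norm1 v := by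
  simp [norm1]

theorem norm1_singleton (a : ℕ+) : norm1 [a] = a := by
  simp [norm1]

theorem norm1_le_of_prefix {u v : Node} (h : u <+: v) : norm1 u ≤ norm1 v := by
  obtain ⟨t, rfl⟩ := h
  rw [norm1_append]
  omega

theorem length_le_norm1 (u : Node) : u.length ≤ norm1 u := by
  induction u with
  | nil => simp
  | cons a t ih =>
    have := a.pos
    simp only [norm1, List.map_cons, List.sum_cons, List.length_cons] at ih ⊢
    omega

theorem prefix_snoc_iff (u w : Node) (a : ℕ+) : u <+: w ++ [a] ↔ u = w ++ [a] ∨ u <+: w :=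
  List.prefix_concat_iff

theorem snoc_prefix_snoc_iff (u w : Node) (a i : ℕ+) :
    u ++ [i] <+: w ++ [a] ↔ (u = w ∧ i = a) ∨ u ++ [i] <+: w := by
  rw [prefix_snoc_iff]
  simp

/-- The number of children of node `j` after `n` choices. -/
def deg (e : Encoding) (n j : ℕ) : ℕ := ((Finset.range n).filter (fun i => (e i : ℕ) = j)).card

theorem word_zero (e : Encoding) : word e 0 = [] := by
  rw [word]

theorem word_succ (e : Encoding) (k : ℕ) :
    word e (k + 1) = word e (e k : ℕ) ++ [Nat.succPNat (deg e k (e k : ℕ))] := by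
  rw [word]
  rfl

theorem deg_succ (e : Encoding) (n j : ℕ) :
    deg e (n + 1) j = deg e n j + if (e n : ℕ) = j then 1 else 0 := by
  unfold deg
  rw [Finset.range_add_one, Finset.filter_insert]
  split_ifs with h
  · rw [Finset.card_insert_of_notMem (by simp)]
  · simp

theorem deg_mono (e : Encoding) (j : ℕ) : Monotone (fun n => deg e n j) :=
  monotone_nat_of_le_succ fun n => by
    change deg e n j ≤ deg e (n + 1) j
    rw [deg_succ]
    omega

theorem deg_eq_zero (e : Encoding) {n j : ℕ} (h : n ≤ j) : deg e n j = 0 := by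
  unfold deg
  rw [Finset.card_eq_zero, Finset.filter_eq_empty_iff]
  intro i hi hij
  have := (e i).isLt
  rw [Finset.mem_range] at hi
  omega

theorem norm1_word_succ (e : Encoding) (k : ℕ) :
    norm1 (word e (k + 1)) = norm1 (word e (e k : ℕ)) + deg e k (e k : ℕ) + 1 := by
  rw [word_succ, norm1_append, norm1_singleton, Nat.succPNat_coe]
  omega

theorem length_word_succ (e : Encoding) (k : ℕ) :
    (word e (k + 1)).length = (word e (e k : ℕ)).length + 1 := by
  rw [word_succ]
  simp

/-- Equal words force equal parents by induction, and then equal birth ranks. This is impossible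
because the parent's degree has grown strictly between the two births. -/
theorem word_ne_of_lt (e : Encoding) (b : ℕ) : ∀ a < b, word e a ≠ word e b := by
  induction b using Nat.strong_induction_on with
  | _ b ih =>
    intro a hab heq
    obtain ⟨b, rfl⟩ : ∃ c, b = c + 1 := ⟨b - 1, by omega⟩
    cases a with
    | zero =>
      rw [word_zero, word_succ] at heq
      simp at heq
    | succ a =>
      rw [word_succ, word_succ] at heq
      obtain ⟨h1, h2⟩ := List.append_inj' heq rfl
      have hp : (e a : ℕ) = (e b : ℕ) := by
        have ha := (e a).isLt
        have hb := (e b).isLt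
        rcases lt_trichotomy (e a : ℕ) (e b : ℕ) with h | h | h
        · exact absurd h1 (ih _ (by omega) _ h)
        · exact h
        · exact absurd h1.symm (ih _ (by omega) _ h)
      have h3 : deg e a (e a : ℕ) = deg e b (e b : ℕ) := by
        simpa using h2
      have h4 : deg e (a + 1) (e b : ℕ) ≤ deg e b (e b : ℕ) := deg_mono e _ (by omega)
      rw [deg_succ, if_pos hp, ← h3, hp] at h4
      omega

theorem word_injective (e : Encoding) : Function.Injective (word e) := by
  intro a b h
  rcases lt_trichotomy a b with hab | hab | hab
  · exact absurd h (word_ne_of_lt e b a hab)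
  · exact hab
  · exact absurd h.symm (word_ne_of_lt e a b hab)

/-- A node can be chosen as parent only after its own birth, so its index plus its degree is at most
the current time. This is why the cut functionals of level `k` vanish before time `k`. -/
theorem norm1_word_le (e : Encoding) (j : ℕ) : norm1 (word e j) ≤ j := by
  induction j using Nat.strong_induction_on with
  | _ j ih =>
    cases j with
    | zero => simp [word_zero, norm1]
    | succ k =>
      rw [norm1_word_succ]
      have h1 := (e k).isLt
      have h2 := ih (e k : ℕ) h1
      have h3 : deg e k (e k : ℕ) + (e k : ℕ) ≤ k := by
        have hsub : (Finset.range k).filter (fun i => (e i : ℕ) = (e k : ℕ)) ⊆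
            Finset.Ico (e k : ℕ) k := by
          intro i hi
          rw [Finset.mem_filter, Finset.mem_range] at hi
          have := (e i).isLt
          rw [Finset.mem_Ico]
          omega
        have := Finset.card_le_card hsub
        rw [Nat.card_Ico] at this
        unfold deg
        omega
      omega

/-- Harris trees are closed under prefixes, and ancestors are born earlier. -/
theorem exists_word_of_prefix (e : Encoding) (u : Node) (j : ℕ) (h : u <+: word e j) :
    ∃ i ≤ j, word e i = u := by
  induction j using Nat.strong_induction_on with
  | _ j ih =>
    cases j with
    | zero =>
      rw [word_zero, List.prefix_nil] at h
      exact ⟨0, le_rfl, by rw [word_zero, h]⟩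
    | succ k =>
      rw [word_succ, prefix_snoc_iff, ← word_succ] at h
      rcases h with h | h
      · exact ⟨k + 1, le_rfl, h.symm⟩
      · have h1 := (e k).isLt
        obtain ⟨i, hi, hu⟩ := ih _ h1 h
        exact ⟨i, by omega, hu⟩

theorem not_word_prefix_of_lt (e : Encoding) {j n : ℕ} (h : j < n) : ¬ word e n <+: word e j := by
  intro hp
  obtain ⟨i, hi, hu⟩ := exists_word_of_prefix e _ _ hp
  have := word_injective e hu
  omega

/-- The number of nodes with prefix `u` after `n` choices. -/
def cnt (e : Encoding) (n : ℕ) (u : Node) : ℕ :=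
  ((Finset.range (n + 1)).filter (fun j => u <+: word e j)).card

theorem cnt_eq_sum (e : Encoding) (n : ℕ) (u : Node) :
    (cnt e n u : ℝ) = ∑ j ∈ Finset.range (n + 1), if u <+: word e j then (1 : ℝ) else 0 := by
  rw [cnt, Finset.card_filter]
  push_cast
  rfl

theorem subtreeSize_harrisTree (e : Encoding) (n : ℕ) (u : Node) :
    subtreeSize (harrisTree e (n + 1)) u = cnt e n u := by
  unfold subtreeSize harrisTree cnt
  rw [Finset.filter_image, Finset.card_image_of_injective _ (word_injective e)]

theorem sum_harrisTree (e : Encoding) (n : ℕ) (f : Node → ℝ) :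
    ∑ u ∈ harrisTree e n, f u = ∑ j ∈ Finset.range n, f (word e j) :=
  Finset.sum_image fun _ _ _ _ h => word_injective e h

theorem cnt_succ (e : Encoding) (n : ℕ) (u : Node) :
    cnt e (n + 1) u = cnt e n u + if u <+: word e (n + 1) then 1 else 0 := by
  unfold cnt
  rw [Finset.range_add_one (n := n + 1), Finset.filter_insert]
  split_ifs with h
  · rw [Finset.card_insert_of_notMem (by simp)]
  · simp

theorem cnt_le (e : Encoding) (n : ℕ) (u : Node) : cnt e n u ≤ n + 1 :=
  (Finset.card_filter_le _ _).trans (by simp)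

theorem cnt_nil (e : Encoding) (n : ℕ) : cnt e n [] = n + 1 := by
  simp [cnt]

theorem cnt_mono (e : Encoding) (u : Node) : Monotone (fun n => cnt e n u) :=
  monotone_nat_of_le_succ fun n => by
    change cnt e n u ≤ cnt e (n + 1) u
    rw [cnt_succ]
    omega

theorem cnt_anti (e : Encoding) (n : ℕ) {u v : Node} (h : u <+: v) : cnt e n v ≤ cnt e n u :=
  Finset.card_le_card fun j hj => by
    rw [Finset.mem_filter] at hj ⊢
    exact ⟨hj.1, h.trans hj.2⟩

theorem cnt_pos_iff (e : Encoding) (n : ℕ) (u : Node) :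
    0 < cnt e n u ↔ ∃ j ≤ n, word e j = u := by
  rw [cnt, Finset.card_pos]
  constructor
  · rintro ⟨j, hj⟩
    rw [Finset.mem_filter, Finset.mem_range] at hj
    obtain ⟨i, hi, hu⟩ := exists_word_of_prefix e u j hj.2
    exact ⟨i, by omega, hu⟩
  · rintro ⟨j, hj, rfl⟩
    exact ⟨j, by simp; omega⟩

theorem cnt_word_succ (e : Encoding) (n : ℕ) : cnt e n (word e (n + 1)) = 0 := by
  by_contra h
  obtain ⟨j, hj, hu⟩ := (cnt_pos_iff e n _).1 (Nat.pos_of_ne_zero h)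
  have := word_injective e hu
  omega

theorem sum_deg (e : Encoding) (n : ℕ) : ∑ j ∈ Finset.range (n + 1), deg e n j = n := by
  induction n with
  | zero => simp [deg]
  | succ n ih =>
    rw [Finset.sum_range_succ, deg_eq_zero e le_rfl]
    simp only [deg_succ, Finset.sum_add_distrib, ih]
    rw [Finset.sum_ite_eq, if_pos (Finset.mem_range.2 (e n).isLt)]

/-! ### Agreement of encodings -/

theorem deg_congr {e e' : Encoding} {n : ℕ} (h : ∀ k < n, e k = e' k) (j : ℕ) :
    deg e n j = deg e' n j := by
  unfold deg
  congr 1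
  refine Finset.filter_congr fun i hi => ?_
  rw [h i (Finset.mem_range.1 hi)]

theorem word_congr {e e' : Encoding} {n : ℕ} (h : ∀ k < n, e k = e' k) {j : ℕ} (hj : j ≤ n) :
    word e j = word e' j := by
  induction j using Nat.strong_induction_on with
  | _ j ih =>
    cases j with
    | zero => rw [word_zero, word_zero]
    | succ k =>
      have hk := (e k).isLt
      rw [word_succ, word_succ, ih _ hk (by omega), deg_congr fun i hi => h i (by omega),
        h k (by omega)]

theorem cnt_congr {e e' : Encoding} {n : ℕ} (h : ∀ k < n, e k = e' k) (u : Node) :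
    cnt e n u = cnt e' n u := by
  unfold cnt
  congr 1
  refine Finset.filter_congr fun j hj => ?_
  rw [Finset.mem_range] at hj
  rw [word_congr h (by omega)]

/-! ### Conditioning on the first choices -/

/-- The encoding that agrees with `x` below `n` and is zero from `n` on. -/
def extend (n : ℕ) (x : (k : Fin n) → Fin (k.1 + 1)) : Encoding :=
  fun k => if h : k < n then x ⟨k, h⟩ else 0

/-- `φ` depends on the first `n` choices only. -/
def DependsBelow {β : Type*} (n : ℕ) (φ : Encoding → β) : Prop :=
  ∀ e e' : Encoding, (∀ k < n, e k = e' k) → φ e = φ e'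

theorem DependsBelow.mono {β : Type*} {n m : ℕ} (h : n ≤ m) {φ : Encoding → β}
    (hφ : DependsBelow n φ) : DependsBelow m φ :=
  fun e e' he => hφ e e' fun k hk => he k (by omega)

theorem DependsBelow.eq_extend {β : Type*} {n : ℕ} {φ : Encoding → β} (hφ : DependsBelow n φ)
    (e : Encoding) : φ e = φ (extend n fun k => e k) :=
  hφ _ _ fun k hk => by simp [extend, hk]

theorem DependsBelow.exists_bound {n : ℕ} {φ : Encoding → ℝ} (hφ : DependsBelow n φ) :
    ∃ K, ∀ e, |φ e| ≤ K := by
  obtain ⟨K, hK⟩ := (Set.finite_range fun x : (k : Fin n) → Fin (k.1 + 1) =>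
    |φ (extend n x)|).bddAbove
  refine ⟨K, fun e => ?_⟩
  rw [hφ.eq_extend e]
  exact hK ⟨_, rfl⟩

section

variable {Ω : Type*} [m0 : MeasurableSpace Ω]

/-- The encoding realized at `ω`. -/
def enc (e : (k : ℕ) → Ω → Fin (k + 1)) (ω : Ω) : Encoding := fun k => e k ω

/-- The σ-field of the first `n` choices. -/
def past (e : (k : ℕ) → Ω → Fin (k + 1)) (he : ∀ k, Measurable (e k)) : Filtration ℕ m0 where
  seq n := ⨆ k ∈ Set.Iio n, MeasurableSpace.comap (e k) ⊤
  mono' _ _ h := biSup_mono fun _ hk => lt_of_lt_of_le hk h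
  le' _ := iSup₂_le fun k _ => (he k).comap_le

theorem measurable_past (e : (k : ℕ) → Ω → Fin (k + 1)) (he : ∀ k, Measurable (e k)) {n k : ℕ}
    (h : k < n) : Measurable[past e he n] (e k) := by
  have h1 : MeasurableSpace.comap (e k) ⊤ ≤ past e he n :=
    le_iSup₂_of_le (f := fun k (_ : k ∈ Set.Iio n) => MeasurableSpace.comap (e k) ⊤) k h le_rfl
  exact fun s _ => h1 _ ⟨s, trivial, rfl⟩

theorem DependsBelow.measurable {β : Type*} [MeasurableSpace β] {n : ℕ} {φ : Encoding → β}
    (hφ : DependsBelow n φ) (e : (k : ℕ) → Ω → Fin (k + 1)) (he : ∀ k, Measurable (e k)) :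
    Measurable[past e he n] (fun ω => φ (enc e ω)) := by
  have h1 : (fun ω => φ (enc e ω)) =
      (fun x : (k : Fin n) → Fin (k.1 + 1) => φ (extend n x)) ∘
        fun ω (k : Fin n) => e k ω := by
    funext ω
    exact hφ.eq_extend _
  rw [h1]
  have h2 : Measurable (fun x : (k : Fin n) → Fin (k.1 + 1) => φ (extend n x)) :=
    Measurable.of_discrete
  refine h2.comp ?_
  exact @measurable_pi_lambda _ _ _ (past e he n) _ _ fun k => measurable_past e he k.2

theorem DependsBelow.measurable' {β : Type*} [MeasurableSpace β] {n : ℕ} {φ : Encoding → β}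
    (hφ : DependsBelow n φ) {e : (k : ℕ) → Ω → Fin (k + 1)} (he : ∀ k, Measurable (e k)) :
    Measurable (fun ω => φ (enc e ω)) :=
  (hφ.measurable e he).mono ((past e he).le n) le_rfl

variable {P : Measure Ω} {e : (k : ℕ) → Ω → Fin (k + 1)}

theorem indep_past (he : IsRRTProcess e P) (n : ℕ) :
    Indep (MeasurableSpace.comap (e n) ⊤) (past e he.measurable n) P := by
  have h := indep_iSup_of_disjoint (μ := P) (m := fun k => MeasurableSpace.comap (e k) ⊤)
    (fun k => (he.measurable k).comap_le) he.indep (S := {n}) (T := Set.Iio n) (by simp)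
  rw [iSup_singleton] at h
  exact h

variable [IsProbabilityMeasure P]

theorem DependsBelow.memLp {n : ℕ} {φ : Encoding → ℝ} (hφ : DependsBelow n φ)
    (he : ∀ k, Measurable (e k)) (p : ENNReal) : MemLp (fun ω => φ (enc e ω)) p P := by
  obtain ⟨K, hK⟩ := hφ.exists_bound
  exact MemLp.of_bound (hφ.measurable' he).aestronglyMeasurable K
    (Eventually.of_forall fun ω => hK _)

theorem DependsBelow.integrable {n : ℕ} {φ : Encoding → ℝ} (hφ : DependsBelow n φ)
    (he : ∀ k, Measurable (e k)) : Integrable (fun ω => φ (enc e ω)) P :=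
  memLp_one_iff_integrable.1 (hφ.memLp he 1)

/-- Given the past, the next parent is uniform on the present nodes. -/
theorem condExp_step (he : IsRRTProcess e P) (n : ℕ) (g : ℕ → Encoding → ℝ)
    (hg : ∀ i ≤ n, DependsBelow n (g i)) :
    P[fun ω => g (e n ω) (enc e ω) | past e he.measurable n] =ᵐ[P]
      fun ω => (∑ i ∈ Finset.range (n + 1), g i (enc e ω)) / (n + 1) := by
  set ind : ℕ → Ω → ℝ := fun i => (e n ⁻¹' {x | (x : ℕ) = i}).indicator 1 with hind
  have hset : ∀ i, MeasurableSet[MeasurableSpace.comap (e n) ⊤] (e n ⁻¹' {x | (x : ℕ) = i}) :=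
    fun i => ⟨_, trivial, rfl⟩
  have hset' : ∀ i, MeasurableSet (e n ⁻¹' {x | (x : ℕ) = i}) :=
    fun i => (he.measurable n).comap_le _ (hset i)
  have h1 : (fun ω => g (e n ω) (enc e ω)) =
      ∑ i ∈ Finset.range (n + 1), (fun ω => g i (enc e ω)) * ind i := by
    funext ω
    rw [Finset.sum_apply]
    have hi : ∀ i, ind i ω = if (e n ω : ℕ) = i then 1 else 0 := by
      intro i
      by_cases h : (e n ω : ℕ) = i <;> simp [hind, h]
    simp only [Pi.mul_apply, hi, mul_ite, mul_one, mul_zero]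
    rw [Finset.sum_ite_eq, if_pos (Finset.mem_range.2 (e n ω).isLt)]
  have hint : ∀ i, Integrable (ind i) P := fun i => (integrable_const 1).indicator (hset' i)
  have hmul : ∀ i ∈ Finset.range (n + 1), Integrable ((fun ω => g i (enc e ω)) * ind i) P := by
    intro i hi
    have hd := hg i (by rw [Finset.mem_range] at hi; omega)
    obtain ⟨K, hK⟩ := hd.exists_bound
    exact (hint i).bdd_mul (c := K) (hd.measurable' he.measurable).aestronglyMeasurable
      (Eventually.of_forall fun ω => hK _)
  rw [h1]
  have h2 : ∀ i ∈ Finset.range (n + 1),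
      P[(fun ω => g i (enc e ω)) * ind i | past e he.measurable n] =ᵐ[P]
        fun ω => g i (enc e ω) / (n + 1) := by
    intro i hi
    have hd := hg i (by rw [Finset.mem_range] at hi; omega)
    have h3 := condExp_mul_of_stronglyMeasurable_left (μ := P)
      (hd.measurable e he.measurable).stronglyMeasurable (hmul i hi) (hint i)
    have h4 : P[ind i | past e he.measurable n] =ᵐ[P] fun _ => P[ind i] :=
      condExp_indep_eq (he.measurable n).comap_le ((past e he.measurable).le n)
        ((stronglyMeasurable_const (b := (1 : ℝ))).indicator (hset i)) (indep_past he n)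
    have h5 : P[ind i] = 1 / ((n : ℝ) + 1) := by
      rw [hind, integral_indicator_one (hset' i)]
      have h6 : {x : Fin (n + 1) | (x : ℕ) = i} = {⟨i, Finset.mem_range.1 hi⟩} := by
        ext x
        simp [Fin.ext_iff]
      rw [measureReal_def, h6, he.uniform]
      rw [ENNReal.toReal_div, ENNReal.toReal_add (by simp) (by simp)]
      simp
    filter_upwards [h3, h4] with ω h3 h4
    rw [h3, Pi.mul_apply, h4, h5]
    ring
  refine (condExp_finsetSum hmul _).trans ?_
  have h7 : ∀ᵐ ω ∂P, ∀ i ∈ Finset.range (n + 1),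
      P[(fun ω => g i (enc e ω)) * ind i | past e he.measurable n] ω = g i (enc e ω) / (n + 1) :=
    (Finset.eventually_all _).2 h2
  filter_upwards [h7] with ω h7
  rw [Finset.sum_apply, Finset.sum_congr rfl h7, Finset.sum_div]

theorem integral_step (he : IsRRTProcess e P) (n : ℕ) (g : ℕ → Encoding → ℝ)
    (hg : ∀ i ≤ n, DependsBelow n (g i)) :
    ∫ ω, g (e n ω) (enc e ω) ∂P =
      ∫ ω, (∑ i ∈ Finset.range (n + 1), g i (enc e ω)) / (n + 1) ∂P := by
  rw [← integral_condExp ((past e he.measurable).le n)]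
  exact integral_congr_ae (condExp_step he n g hg)

/-- A sequence of functionals whose conditional mean does not decrease is a submartingale. -/
theorem submartingale_of_step (he : IsRRTProcess e P) (R : ℕ → Encoding → ℝ)
    (hR : ∀ n, DependsBelow n (R n)) (g : ℕ → ℕ → Encoding → ℝ)
    (hg : ∀ n, ∀ i ≤ n, DependsBelow n (g n i))
    (hstep : ∀ n x, g n (x n) x ≤ R (n + 1) x)
    (hmean : ∀ n x, R n x ≤ (∑ i ∈ Finset.range (n + 1), g n i x) / (n + 1)) :
    Submartingale (fun n ω => R n (enc e ω)) (past e he.measurable) P := by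
  refine submartingale_nat (fun n => ((hR n).measurable e he.measurable).stronglyMeasurable)
    (fun n => (hR n).integrable he.measurable) fun n => ?_
  have hd : DependsBelow (n + 1) (fun x => g n (x n) x) := by
    intro x y hxy
    have hn := (x n).isLt
    change g n (x n) x = g n (y n) y
    rw [← hxy n (by omega)]
    exact hg n _ (by omega) _ _ fun k hk => hxy k (by omega)
  have h1 : P[fun ω => g n (e n ω) (enc e ω) | past e he.measurable n] ≤ᵐ[P]
      P[fun ω => R (n + 1) (enc e ω) | past e he.measurable n] :=
    condExp_mono (hd.integrable he.measurable) ((hR (n + 1)).integrable he.measurable)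
      (Eventually.of_forall fun ω => hstep n (enc e ω))
  filter_upwards [h1, condExp_step he n (g n) (hg n)] with ω h1 h2
  exact (hmean n (enc e ω)).trans (h2.symm.le.trans h1)

/-- Doob's convergence theorem, with the `L¹` bound stated as a real integral. -/
theorem ae_exists_tendsto_of_submartingale {ℱ : Filtration ℕ m0} {f : ℕ → Ω → ℝ}
    (hf : Submartingale f ℱ P) {K : ℝ} (hK : ∀ n, ∫ ω, |f n ω| ∂P ≤ K) :
    ∀ᵐ ω ∂P, ∃ c, Tendsto (fun n => f n ω) atTop (𝓝 c) := by
  refine hf.exists_ae_tendsto_of_bdd (R := K.toNNReal) fun n => ?_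
  rw [eLpNorm_one_eq_lintegral_enorm, ← ofReal_integral_norm_eq_lintegral_enorm (hf.integrable n)]
  exact ENNReal.ofReal_le_ofReal (hK n)

end

/-! ### Moment bounds for urn functionals -/

/-- The depth of the open slot at node `j` in the binary tree of births and siblings. -/
def height (e : Encoding) (n j : ℕ) : ℕ := norm1 (word e j) + deg e n j

theorem sum_range_update (n i : ℕ) (hi : i ≤ n) (F G : ℕ → ℝ)
    (h : ∀ j ≤ n, j ≠ i → G j = F j) :
    ∑ j ∈ Finset.range (n + 2), G j =
      ∑ j ∈ Finset.range (n + 1), F j + (G i - F i) + G (n + 1) := by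
  rw [Finset.sum_range_succ]
  have h1 : ∑ j ∈ Finset.range (n + 1), (G j - F j) = G i - F i := by
    refine Finset.sum_eq_single i (fun j hj hji => ?_) fun hn => ?_
    · rw [h j (by rw [Finset.mem_range] at hj; omega) hji, sub_self]
    · exact absurd (Finset.mem_range.2 (by omega)) hn
  rw [Finset.sum_sub_distrib] at h1
  linarith

theorem height_succ_of_ne (e : Encoding) {n j : ℕ} (h : j ≠ e n) :
    height e (n + 1) j = height e n j := by
  rw [height, height, deg_succ, if_neg fun h' => h h'.symm, add_zero]

theorem height_succ_parent (e : Encoding) (n : ℕ) :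
    height e (n + 1) (e n) = height e n (e n) + 1 := by
  rw [height, height, deg_succ, if_pos rfl]
  omega

theorem height_succ_new (e : Encoding) (n : ℕ) :
    height e (n + 1) (n + 1) = height e n (e n) + 1 := by
  rw [height, height, deg_eq_zero e le_rfl, norm1_word_succ]

theorem dependsBelow_height {n j : ℕ} (hj : j ≤ n) : DependsBelow n (fun x => height x n j) := by
  intro x y h
  change norm1 _ + _ = norm1 _ + _
  rw [word_congr h hj, deg_congr h]

theorem DependsBelow.sum {ι : Type*} {n : ℕ} {s : Finset ι} {f : ι → Encoding → ℝ}
    (h : ∀ i ∈ s, DependsBelow n (f i)) : DependsBelow n (fun x => ∑ i ∈ s, f i x) :=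
  fun x y hxy => Finset.sum_congr rfl fun i hi => h i hi x y hxy

theorem DependsBelow.comp {β γ : Type*} {n : ℕ} {f : Encoding → β} (h : DependsBelow n f)
    (F : β → γ) : DependsBelow n (fun x => F (f x)) :=
  fun x y hxy => congrArg F (h x y hxy)

theorem sum_pow_height_succ (e : Encoding) (n : ℕ) :
    ∑ j ∈ Finset.range (n + 2), (3 / 2 : ℝ) ^ height e (n + 1) j =
      ∑ j ∈ Finset.range (n + 1), (3 / 2 : ℝ) ^ height e n j + 2 * (3 / 2) ^ height e n (e n) := by
  rw [sum_range_update n (e n) (Nat.lt_succ_iff.1 (e n).isLt)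
    (fun j => (3 / 2 : ℝ) ^ height e n j) _ fun j _ hj => by
      rw [height_succ_of_ne e hj]]
  rw [height_succ_parent, height_succ_new, pow_succ]
  ring

section

variable {Ω : Type*} [MeasurableSpace Ω] {P : Measure Ω} [IsProbabilityMeasure P]
  {e : (k : ℕ) → Ω → Fin (k + 1)}

/-- A step replaces a slot of height `h` by two of height `h + 1`. With base `3 / 2` the weight
gained is `2 * (3 / 2) ^ (h + 1) - (3 / 2) ^ h = 2 * (3 / 2) ^ h`, so the mean total weight is
multiplied by `(n + 3) / (n + 1)`. The growth is only quadratic, hence linear per node. -/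
theorem integral_sum_pow_height (he : IsRRTProcess e P) (n : ℕ) :
    ∫ ω, ∑ j ∈ Finset.range (n + 1), (3 / 2 : ℝ) ^ height (enc e ω) n j ∂P =
      ((n : ℝ) + 1) * (n + 2) / 2 := by
  have hd : ∀ n, ∀ j ≤ n, DependsBelow n (fun x => (3 / 2 : ℝ) ^ height x n j) := fun n j hj =>
    (dependsBelow_height hj).comp fun k => (3 / 2 : ℝ) ^ k
  induction n with
  | zero => simp [height, word_zero, norm1, deg]
  | succ n ih =>
    have hS : DependsBelow n (fun x => ∑ j ∈ Finset.range (n + 1), (3 / 2 : ℝ) ^ height x n j) :=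
      DependsBelow.sum fun j hj => hd n j (by rw [Finset.mem_range] at hj; omega)
    have h1 := integral_step he n (fun i x =>
      ∑ j ∈ Finset.range (n + 1), (3 / 2 : ℝ) ^ height x n j + 2 * (3 / 2) ^ height x n i)
      fun i hi x y hxy => congrArg₂ (fun a b : ℝ => a + 2 * b) (hS x y hxy) (hd n i hi x y hxy)
    have h2 : ∀ ω, ∑ j ∈ Finset.range (n + 1 + 1), (3 / 2 : ℝ) ^ height (enc e ω) (n + 1) j =
        ∑ j ∈ Finset.range (n + 1), (3 / 2 : ℝ) ^ height (enc e ω) n j +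
          2 * (3 / 2) ^ height (enc e ω) n (e n ω) := fun ω => sum_pow_height_succ (enc e ω) n
    simp only [h2, h1]
    have h3 : ∀ ω, (∑ i ∈ Finset.range (n + 1),
        (∑ j ∈ Finset.range (n + 1), (3 / 2 : ℝ) ^ height (enc e ω) n j +
          2 * (3 / 2) ^ height (enc e ω) n i)) / ((n : ℝ) + 1) =
        ((n : ℝ) + 3) / (n + 1) *
          ∑ j ∈ Finset.range (n + 1), (3 / 2 : ℝ) ^ height (enc e ω) n j := by
      intro ω
      have : (n : ℝ) + 1 ≠ 0 := by positivity
      rw [Finset.sum_add_distrib, ← Finset.mul_sum, Finset.sum_const, Finset.card_range,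
        nsmul_eq_mul]
      push_cast
      field_simp
      ring
    simp only [h3]
    rw [integral_const_mul, ih]
    push_cast
    field_simp
    ring

end

/-- The bound on the increments of the functionals at node `j`. -/
noncomputable def incBound (e : Encoding) (n j : ℕ) : ℝ :=
  height e n j + ((harmonic (n + 1) : ℝ) + 1)

theorem harmonic_nonneg (n : ℕ) : (0 : ℝ) ≤ harmonic n := by
  unfold harmonic
  push_cast
  positivity

theorem incBound_nonneg (e : Encoding) (n j : ℕ) : 0 ≤ incBound e n j := by
  have := harmonic_nonneg (n + 1)
  unfold incBound
  positivity

/-- Powers are absorbed by exponentials through `x ^ p / p! ≤ exp x`. It is applied to `h log (3 /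
2)` for the height and to the harmonic term, whose exponential is of order `n`. -/
theorem exists_incBound_pow_le (p : ℕ) : ∃ K : ℝ, 0 ≤ K ∧ ∀ (e : Encoding) (n j : ℕ),
    incBound e n j ^ p ≤ K * ((3 / 2) ^ height e n j + (n + 2)) := by
  have hl : 0 < Real.log (3 / 2) := Real.log_pos (by norm_num)
  set K1 : ℝ := (p.factorial : ℝ) / Real.log (3 / 2) ^ p with hK1
  set K2 : ℝ := (p.factorial : ℝ) * Real.exp 2 with hK2
  have h1 : ∀ h : ℕ, (h : ℝ) ^ p ≤ K1 * (3 / 2) ^ h := by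
    intro h
    have h2 := Real.pow_div_factorial_le_exp (h * Real.log (3 / 2)) (by positivity) p
    have h3 : Real.exp (h * Real.log (3 / 2)) = (3 / 2 : ℝ) ^ h := by
      rw [Real.exp_nat_mul, Real.exp_log (by norm_num)]
    rw [h3, mul_pow, div_le_iff₀ (by positivity)] at h2
    rw [hK1, div_mul_eq_mul_div, le_div_iff₀ (by positivity)]
    linarith
  have h2 : ∀ n : ℕ, ((harmonic (n + 1) : ℝ) + 1) ^ p ≤ K2 * (n + 2) := by
    intro n
    have h3 := harmonic_le_one_add_log (n + 1)
    have h0 := harmonic_nonneg (n + 1)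
    have h4 := Real.pow_div_factorial_le_exp ((harmonic (n + 1) : ℝ) + 1) (by positivity) p
    have h5 : Real.exp ((harmonic (n + 1) : ℝ) + 1) ≤ Real.exp 2 * (n + 2) := by
      calc Real.exp ((harmonic (n + 1) : ℝ) + 1)
          ≤ Real.exp (2 + Real.log ((n + 1 : ℕ) : ℝ)) := Real.exp_le_exp.2 (by linarith)
        _ = Real.exp 2 * ((n + 1 : ℕ) : ℝ) := by
            rw [Real.exp_add, Real.exp_log (by positivity)]
        _ ≤ Real.exp 2 * (n + 2) := by
            gcongr
            push_cast
            linarith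
    rw [div_le_iff₀ (by positivity)] at h4
    calc _ ≤ Real.exp ((harmonic (n + 1) : ℝ) + 1) * p.factorial := h4
      _ ≤ Real.exp 2 * (n + 2) * p.factorial := by gcongr
      _ = _ := by rw [hK2]; ring
  refine ⟨2 ^ (p - 1) * (K1 + K2), by positivity, fun e n j => ?_⟩
  have h0 := harmonic_nonneg (n + 1)
  have hK1' : 0 ≤ K1 := by positivity
  have hK2' : 0 ≤ K2 := by positivity
  calc incBound e n j ^ p
      ≤ 2 ^ (p - 1) * ((height e n j : ℝ) ^ p + ((harmonic (n + 1) : ℝ) + 1) ^ p) :=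
        add_pow_le (by positivity) (by positivity) p
    _ ≤ 2 ^ (p - 1) * (K1 * (3 / 2) ^ height e n j + K2 * (n + 2)) := by
        gcongr
        · exact h1 _
        · exact h2 _
    _ ≤ 2 ^ (p - 1) * ((K1 + K2) * ((3 / 2) ^ height e n j + (n + 2))) := by
        gcongr
        have : 0 ≤ K2 * (3 / 2 : ℝ) ^ height e n j := by positivity
        have : 0 ≤ K1 * ((n : ℝ) + 2) := by positivity
        nlinarith
    _ = _ := by ring

theorem abs_pow_mul_abs_pow_le (a b : ℝ) (i j : ℕ) :
    |a| ^ i * |b| ^ j ≤ |a| ^ (i + j) + |b| ^ (i + j) := by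
  rcases le_total |a| |b| with h | h
  · calc |a| ^ i * |b| ^ j ≤ |b| ^ i * |b| ^ j := by gcongr
      _ = |b| ^ (i + j) := (pow_add _ _ _).symm
      _ ≤ _ := le_add_of_nonneg_left (by positivity)
  · calc |a| ^ i * |b| ^ j ≤ |a| ^ i * |a| ^ j := by gcongr
      _ = |a| ^ (i + j) := (pow_add _ _ _).symm
      _ ≤ _ := le_add_of_nonneg_right (by positivity)

/-- In the binomial expansion every term after the first two contains at least `s ^ 2`, mixed
products are dominated by pure powers, and the coefficients sum to at most `2 ^ (k + 2)`. The linear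
term is kept exactly because it averages to zero for martingale increments. -/
theorem add_mul_pow_le (k : ℕ) (x y s : ℝ) (hs0 : 0 ≤ s) (hs1 : s ≤ 1) :
    (x + s * y) ^ (k + 2) ≤ x ^ (k + 2) + (k + 2) * x ^ (k + 1) * (s * y) +
      2 ^ (k + 2) * s ^ 2 * (|x| ^ (k + 2) + |y| ^ (k + 2)) := by
  rw [add_comm x, add_pow, Finset.sum_range_succ', Finset.sum_range_succ']
  have h1 : ∑ m ∈ Finset.range (k + 1), (s * y) ^ (m + 1 + 1) * x ^ (k - m) *
      ((k + 2).choose (m + 1 + 1) : ℝ) ≤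
      ∑ m ∈ Finset.range (k + 1), s ^ 2 * (|x| ^ (k + 2) + |y| ^ (k + 2)) *
        ((k + 2).choose (m + 1 + 1) : ℝ) := by
    refine Finset.sum_le_sum fun m hm => ?_
    rw [Finset.mem_range] at hm
    refine mul_le_mul_of_nonneg_right ?_ (by positivity)
    have h2 := abs_pow_mul_abs_pow_le y x (m + 2) (k - m)
    rw [show m + 2 + (k - m) = k + 2 by omega] at h2
    calc (s * y) ^ (m + 1 + 1) * x ^ (k - m)
        ≤ |(s * y) ^ (m + 1 + 1) * x ^ (k - m)| := le_abs_self _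
      _ = s ^ 2 * s ^ m * (|y| ^ (m + 2) * |x| ^ (k - m)) := by
          rw [abs_mul, abs_pow, abs_pow, abs_mul, abs_of_nonneg hs0, mul_pow]
          ring
      _ ≤ s ^ 2 * 1 * (|x| ^ (k + 2) + |y| ^ (k + 2)) := by
          gcongr
          · exact pow_le_one₀ hs0 hs1
          · linarith
      _ = _ := by ring
  have h3 : ∑ m ∈ Finset.range (k + 1), ((k + 2).choose (m + 1 + 1) : ℝ) ≤ 2 ^ (k + 2) := by
    have h4 := Nat.sum_range_choose (k + 2)
    rw [Finset.sum_range_succ', Finset.sum_range_succ'] at h4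
    have h5 : ∑ m ∈ Finset.range (k + 1), (k + 2).choose (m + 1 + 1) ≤ 2 ^ (k + 2) := by omega
    exact_mod_cast h5
  rw [← Finset.mul_sum] at h1
  have h6 := mul_le_mul_of_nonneg_left h3
    (by positivity : 0 ≤ s ^ 2 * (|x| ^ (k + 2) + |y| ^ (k + 2)))
  simp only [zero_add, pow_one, pow_zero, Nat.choose_zero_right, Nat.choose_one_right,
    Nat.cast_one, mul_one, one_mul, Nat.sub_zero, Nat.reduceSubDiff]
  push_cast
  linarith

/-- The scale of the variance of the increments. -/
noncomputable def scale (n : ℕ) : ℝ := 1 / Real.sqrt (n + 2) ^ 3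

theorem scale_pos (n : ℕ) : 0 < scale n := by
  unfold scale
  positivity

theorem one_le_sqrt_add_two (n : ℕ) : 1 ≤ Real.sqrt ((n : ℝ) + 2) := by
  rw [Real.one_le_sqrt]
  linarith [(Nat.cast_nonneg n : (0 : ℝ) ≤ n)]

theorem scale_le_one (n : ℕ) : scale n ≤ 1 := by
  unfold scale
  rw [div_le_one (by positivity)]
  exact one_le_pow₀ (one_le_sqrt_add_two n)

theorem summable_scale : Summable scale := by
  have h : Summable fun n : ℕ => 1 / (n : ℝ) ^ (3 / 2 : ℝ) :=
    Real.summable_one_div_nat_rpow.2 (by norm_num)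
  refine ((summable_nat_add_iff 2).2 h).congr fun n => ?_
  unfold scale
  rw [Real.sqrt_eq_rpow, ← Real.rpow_natCast, ← Real.rpow_mul (by positivity)]
  norm_num

/-! ### Normalized urn functionals: martingale property and even moments. -/

/-- A functional that grows by its value at the chosen parent, with the parents' values adding
up to the functional itself and bounded by `incBound`. -/
structure IsUrn (Q : ℕ → Encoding → ℝ) (q : ℕ → ℕ → Encoding → ℝ) : Prop where
  dep : ∀ n, ∀ j ≤ n, DependsBelow n (q n j)
  sum : ∀ n x, Q n x = ∑ j ∈ Finset.range (n + 1), q n j x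
  step : ∀ n x, Q (n + 1) x = Q n x + q n (x n) x
  bound : ∀ n x, ∀ j ≤ n, |q n j x| ≤ incBound x n j

namespace IsUrn

variable {Q : ℕ → Encoding → ℝ} {q : ℕ → ℕ → Encoding → ℝ}

theorem dep_total (h : IsUrn Q q) (n : ℕ) : DependsBelow n (Q n) := by
  have h1 : Q n = fun x => ∑ j ∈ Finset.range (n + 1), q n j x := funext (h.sum n)
  rw [h1]
  exact DependsBelow.sum fun j hj => h.dep n j (by rw [Finset.mem_range] at hj; omega)

/-- The normalized functional. -/
noncomputable def ratio (Q : ℕ → Encoding → ℝ) (n : ℕ) (x : Encoding) : ℝ := Q n x / (n + 1)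

/-- The increment of the normalized functional for parent `j`. -/
noncomputable def incr (Q : ℕ → Encoding → ℝ) (q : ℕ → ℕ → Encoding → ℝ) (n j : ℕ)
    (x : Encoding) : ℝ := (q n j x - ratio Q n x) / (n + 2)

theorem dep_ratio (h : IsUrn Q q) (n : ℕ) : DependsBelow n (ratio Q n) :=
  (h.dep_total n).comp fun y => y / ((n : ℝ) + 1)

theorem dep_incr (h : IsUrn Q q) (n j : ℕ) (hj : j ≤ n) : DependsBelow n (incr Q q n j) := by
  intro x y hxy
  unfold incr
  rw [h.dep n j hj x y hxy, h.dep_ratio n x y hxy]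

theorem ratio_succ (h : IsUrn Q q) (n : ℕ) (x : Encoding) :
    ratio Q (n + 1) x = ratio Q n x + incr Q q n (x n) x := by
  unfold incr ratio
  rw [h.step]
  push_cast
  field_simp
  ring

/-- This is the martingale property: the average of the parents' values is the normalized functional
itself. -/
theorem sum_incr (h : IsUrn Q q) (n : ℕ) (x : Encoding) :
    ∑ j ∈ Finset.range (n + 1), incr Q q n j x = 0 := by
  unfold incr
  rw [← Finset.sum_div, Finset.sum_sub_distrib, ← h.sum, Finset.sum_const, Finset.card_range,
    nsmul_eq_mul, ratio]
  push_cast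
  field_simp
  simp

/-- By Jensen, the power of the mean `ratio Q n` is at most the mean power of the increment bounds,
so subtracting the mean costs only a factor `2 ^ (k + 1)`. -/
theorem sum_abs_incr_pow_le (h : IsUrn Q q) (k n : ℕ) (x : Encoding) :
    ∑ j ∈ Finset.range (n + 1), |incr Q q n j x| ^ (k + 1) ≤
      2 ^ (k + 1) / ((n : ℝ) + 2) ^ (k + 1) *
        ∑ j ∈ Finset.range (n + 1), incBound x n j ^ (k + 1) := by
  have hR : |ratio Q n x| ^ (k + 1) ≤
      (∑ j ∈ Finset.range (n + 1), incBound x n j ^ (k + 1)) / (n + 1) := by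
    have h1 : |ratio Q n x| ≤ (∑ j ∈ Finset.range (n + 1), incBound x n j) / (n + 1) := by
      rw [ratio, abs_div, abs_of_pos (by positivity : (0 : ℝ) < n + 1), h.sum]
      gcongr
      refine (Finset.abs_sum_le_sum_abs _ _).trans (Finset.sum_le_sum fun j hj => ?_)
      exact h.bound n x j (by rw [Finset.mem_range] at hj; omega)
    have h2 := pow_sum_div_card_le_sum_pow (s := Finset.range (n + 1))
      (f := incBound x n) (fun j _ => incBound_nonneg x n j) k
    rw [Finset.card_range] at h2
    push_cast at h2
    calc |ratio Q n x| ^ (k + 1)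
        ≤ ((∑ j ∈ Finset.range (n + 1), incBound x n j) / (n + 1)) ^ (k + 1) := by gcongr
      _ = (∑ j ∈ Finset.range (n + 1), incBound x n j) ^ (k + 1) / ((n : ℝ) + 1) ^ k /
          (n + 1) := by
          rw [div_pow, pow_succ ((n : ℝ) + 1), div_div]
      _ ≤ _ := by gcongr
  have hj : ∀ j ∈ Finset.range (n + 1), |incr Q q n j x| ^ (k + 1) ≤
      2 ^ k / ((n : ℝ) + 2) ^ (k + 1) * (incBound x n j ^ (k + 1) +
        (∑ j ∈ Finset.range (n + 1), incBound x n j ^ (k + 1)) / (n + 1)) := by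
    intro j hj
    have h1 : |q n j x| ≤ incBound x n j := h.bound n x j (by rw [Finset.mem_range] at hj; omega)
    rw [incr, abs_div, abs_of_pos (by positivity : (0 : ℝ) < n + 2), div_pow,
      div_mul_eq_mul_div]
    gcongr
    calc |q n j x - ratio Q n x| ^ (k + 1) ≤ (|q n j x| + |ratio Q n x|) ^ (k + 1) := by
          gcongr
          exact abs_sub _ _
      _ ≤ 2 ^ (k + 1 - 1) * (|q n j x| ^ (k + 1) + |ratio Q n x| ^ (k + 1)) :=
          add_pow_le (abs_nonneg _) (abs_nonneg _) _
      _ ≤ _ := by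
          rw [Nat.add_sub_cancel]
          gcongr
  refine (Finset.sum_le_sum hj).trans (le_of_eq ?_)
  rw [← Finset.mul_sum, Finset.sum_add_distrib, Finset.sum_const, Finset.card_range, nsmul_eq_mul]
  push_cast
  field_simp
  ring

variable {Ω : Type*} [MeasurableSpace Ω] {P : Measure Ω} [IsProbabilityMeasure P]
  {e : (k : ℕ) → Ω → Fin (k + 1)}

theorem integral_sum_incBound_pow_le (he : IsRRTProcess e P) {p : ℕ} {K : ℝ} (hK0 : 0 ≤ K)
    (hK : ∀ (e : Encoding) (n j : ℕ),
      incBound e n j ^ p ≤ K * ((3 / 2) ^ height e n j + (n + 2))) (n : ℕ) :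
    ∫ ω, ∑ j ∈ Finset.range (n + 1), incBound (enc e ω) n j ^ p ∂P ≤
      2 * K * ((n + 1) * (n + 2)) := by
  have hd : DependsBelow n
      (fun x => ∑ j ∈ Finset.range (n + 1), (3 / 2 : ℝ) ^ height x n j) :=
    DependsBelow.sum fun j hj => (dependsBelow_height (by rw [Finset.mem_range] at hj; omega)).comp
      fun k => (3 / 2 : ℝ) ^ k
  have hd' : DependsBelow n (fun x => ∑ j ∈ Finset.range (n + 1), incBound x n j ^ p) :=
    DependsBelow.sum fun j hj => (dependsBelow_height (by rw [Finset.mem_range] at hj; omega)).comp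
      fun k => ((k : ℝ) + ((harmonic (n + 1) : ℝ) + 1)) ^ p
  have h1 : ∀ ω, ∑ j ∈ Finset.range (n + 1), incBound (enc e ω) n j ^ p ≤
      K * (∑ j ∈ Finset.range (n + 1), (3 / 2 : ℝ) ^ height (enc e ω) n j + (n + 1) * (n + 2)) := by
    intro ω
    refine (Finset.sum_le_sum fun j _ => hK (enc e ω) n j).trans (le_of_eq ?_)
    rw [← Finset.mul_sum, Finset.sum_add_distrib, Finset.sum_const, Finset.card_range,
      nsmul_eq_mul]
    push_cast
    ring
  have hi := hd.integrable (P := P) he.measurable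
  refine (integral_mono (hd'.integrable he.measurable)
    ((hi.add (integrable_const _)).const_mul K) h1).trans ?_
  rw [integral_const_mul]
  have h2 := integral_add hi (integrable_const (μ := P) (((n : ℝ) + 1) * (n + 2)))
  simp only [Pi.add_apply] at h2 ⊢
  rw [h2, integral_sum_pow_height he, integral_const, probReal_univ, one_smul]
  have : 0 ≤ K * (((n : ℝ) + 1) * (n + 2)) := by positivity
  linarith

/-- One step of a Gronwall argument. The `p`-th moment `a` satisfies a recursion of the form `a' ≤
(1 + c t) a + c' t` with the summable rate `t = scale n`; adding `1` to both sides makes it purely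
multiplicative. -/
theorem integral_pow_succ_le (he : IsRRTProcess e P) (h : IsUrn Q q) {k : ℕ} {K : ℝ}
    (hK0 : 0 ≤ K) (hK : ∀ (e : Encoding) (n j : ℕ),
      incBound e n j ^ (2 * (k + 2)) ≤ K * ((3 / 2) ^ height e n j + (n + 2)))
    {m n : ℕ} (hmn : m ≤ n) :
    ∫ ω, (ratio Q (n + 1) (enc e ω) - ratio Q m (enc e ω)) ^ (2 * (k + 2)) ∂P + 1 ≤
      (∫ ω, (ratio Q n (enc e ω) - ratio Q m (enc e ω)) ^ (2 * (k + 2)) ∂P + 1) *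
        (1 + 2 ^ (2 * (k + 2)) * (1 + 2 ^ (2 * (k + 2)) * (2 * K)) * scale n) := by
  set p := 2 * (k + 2) with hp
  have hpk : p = (2 * k + 2) + 2 := by omega
  have heven : Even p := ⟨k + 2, by omega⟩
  set d : Encoding → ℝ := fun x => ratio Q n x - ratio Q m x with hd
  have hdd : DependsBelow n d := by
    intro x y hxy
    simp only [hd]
    rw [h.dep_ratio n x y hxy, (h.dep_ratio m).mono hmn x y hxy]
  set t := scale n with ht
  have ht0 : 0 < t := scale_pos n
  have ht1 : t ≤ 1 := scale_le_one n
  -- The Taylor-type majorant of the next power, as a function of the chosen parent `j`. It comes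
  -- from `add_mul_pow_le` with `s = √t` and `y = D / √t`, so that `s * y` is the increment `D`
  -- while the error carries the factor `t`.
  set g : ℕ → Encoding → ℝ := fun j x => d x ^ p +
    (((2 * k + 2 : ℕ) : ℝ) + 2) * d x ^ (p - 1) * incr Q q n j x +
    2 ^ p * t * (d x ^ p + |incr Q q n j x| ^ p / t ^ (k + 2)) with hg
  have hgd : ∀ j ≤ n, DependsBelow n (g j) := by
    intro j hj x y hxy
    simp only [hg]
    rw [hdd x y hxy, h.dep_incr n j hj x y hxy]
  have hpt : ∀ ω, (ratio Q (n + 1) (enc e ω) - ratio Q m (enc e ω)) ^ p ≤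
      g (e n ω) (enc e ω) := by
    intro ω
    have hen : enc e ω n = e n ω := rfl
    rw [h.ratio_succ, hen]
    set D := incr Q q n (e n ω) (enc e ω) with hD
    have hs : Real.sqrt t * (D / Real.sqrt t) = D := by
      field_simp
    have h1 := add_mul_pow_le (2 * k + 2) (d (enc e ω)) (D / Real.sqrt t) (Real.sqrt t)
      (Real.sqrt_nonneg _) (Real.sqrt_le_one.2 ht1)
    rw [hs, Real.sq_sqrt ht0.le, ← hpk, heven.pow_abs, abs_div, div_pow,
      abs_of_nonneg (Real.sqrt_nonneg t)] at h1
    have h2 : Real.sqrt t ^ p = t ^ (k + 2) := by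
      rw [hp, pow_mul, Real.sq_sqrt ht0.le]
    rw [h2] at h1
    have h3 : ratio Q n (enc e ω) + D - ratio Q m (enc e ω) = d (enc e ω) + D := by
      simp only [hd]
      ring
    rw [h3]
    simp only [hg]
    rw [show p - 1 = 2 * k + 2 + 1 by omega]
    exact h1
  have hdep1 : DependsBelow (n + 1) (fun x => (ratio Q (n + 1) x - ratio Q m x) ^ p) := by
    intro x y hxy
    simp only
    rw [h.dep_ratio (n + 1) x y hxy, (h.dep_ratio m).mono (by omega) x y hxy]
  have hdep2 : DependsBelow (n + 1) (fun x => g (x n) x) := by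
    intro x y hxy
    have hn := (x n).isLt
    simp only
    rw [← hxy n (by omega)]
    exact hgd _ (by omega) _ _ fun k hk => hxy k (by omega)
  set B : Encoding → ℝ := fun x => ∑ j ∈ Finset.range (n + 1), incBound x n j ^ p with hB
  have hBd : DependsBelow n B :=
    DependsBelow.sum fun j hj => (dependsBelow_height (by rw [Finset.mem_range] at hj; omega)).comp
      fun k => ((k : ℝ) + ((harmonic (n + 1) : ℝ) + 1)) ^ p
  set c : ℝ := 2 ^ p * t * (2 ^ p / ((n : ℝ) + 2) ^ p / t ^ (k + 2)) / (n + 1) with hc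
  have havg : ∀ x, (∑ j ∈ Finset.range (n + 1), g j x) / ((n : ℝ) + 1) ≤
      (1 + 2 ^ p * t) * d x ^ p + c * B x := by
    intro x
    have h1 : ∑ j ∈ Finset.range (n + 1), g j x = ((n : ℝ) + 1) * ((1 + 2 ^ p * t) * d x ^ p) +
        2 ^ p * t * ((∑ j ∈ Finset.range (n + 1), |incr Q q n j x| ^ p) / t ^ (k + 2)) := by
      simp only [hg]
      rw [Finset.sum_add_distrib, Finset.sum_add_distrib, ← Finset.mul_sum, h.sum_incr,
        ← Finset.mul_sum, Finset.sum_add_distrib, ← Finset.sum_div, Finset.sum_const,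
        Finset.card_range, nsmul_eq_mul]
      push_cast
      ring
    have h2 : ∑ j ∈ Finset.range (n + 1), |incr Q q n j x| ^ p ≤
        2 ^ p / ((n : ℝ) + 2) ^ p * B x := by
      have := h.sum_abs_incr_pow_le (2 * k + 3) n x
      rw [show 2 * k + 3 + 1 = p by omega] at this
      exact this
    rw [h1, add_div, mul_div_cancel_left₀ _ (by positivity)]
    gcongr
    calc _ ≤ 2 ^ p * t * ((2 ^ p / ((n : ℝ) + 2) ^ p * B x) / t ^ (k + 2)) / (n + 1) := by gcongr
      _ = _ := by
        rw [hc]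
        ring
  have hc0 : 0 ≤ c := by positivity
  have hmain : ∫ ω, (ratio Q (n + 1) (enc e ω) - ratio Q m (enc e ω)) ^ p ∂P ≤
      (1 + 2 ^ p * t) * ∫ ω, d (enc e ω) ^ p ∂P + c * (2 * K * ((n + 1) * (n + 2))) := by
    have hi1 := (hdd.comp fun y => y ^ p).integrable (P := P) he.measurable
    have hi2 := hBd.integrable (P := P) he.measurable
    calc _ ≤ ∫ ω, g (e n ω) (enc e ω) ∂P :=
          integral_mono (hdep1.integrable he.measurable) (hdep2.integrable he.measurable) hpt
      _ = ∫ ω, (∑ i ∈ Finset.range (n + 1), g i (enc e ω)) / (n + 1) ∂P :=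
          integral_step he n g hgd
      _ ≤ ∫ ω, ((1 + 2 ^ p * t) * d (enc e ω) ^ p + c * B (enc e ω)) ∂P := by
          refine integral_mono ?_ ((hi1.const_mul _).add (hi2.const_mul _)) fun ω => havg _
          exact (((DependsBelow.sum fun i hi => hgd i (by rw [Finset.mem_range] at hi; omega)).comp
            fun y => y / ((n : ℝ) + 1)).integrable he.measurable)
      _ = (1 + 2 ^ p * t) * ∫ ω, d (enc e ω) ^ p ∂P + c * ∫ ω, B (enc e ω) ∂P := by
          rw [integral_add (hi1.const_mul _) (hi2.const_mul _), integral_const_mul,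
            integral_const_mul]
      _ ≤ _ := by
          gcongr
          exact integral_sum_incBound_pow_le he hK0 hK n
  -- With `r = √(n + 2)` and `t = r ^ (-3)` this reduces to `2 + 3 * (k + 2) ≤ 4 * (k + 2)`. It
  -- holds exactly when the exponent `p = 2 * (k + 2)` is at least 4, which is why the exponents
  -- start there.
  have hcK : c * (2 * K * ((n + 1) * (n + 2))) ≤ 2 ^ p * (2 ^ p * (2 * K)) * t := by
    set r := Real.sqrt ((n : ℝ) + 2) with hr
    have hr1 : 1 ≤ r := one_le_sqrt_add_two n
    have hr2 : (n : ℝ) + 2 = r ^ 2 := (Real.sq_sqrt (by positivity)).symm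
    have hr0 : 0 < r := by positivity
    have h1 : c * (2 * K * ((n + 1) * (n + 2))) =
        2 ^ p * (2 ^ p * (2 * K)) * t * ((((n : ℝ) + 2) / (((n : ℝ) + 2) ^ p * t ^ (k + 2)))) := by
      rw [hc]
      field_simp
    rw [h1]
    refine mul_le_of_le_one_right (by positivity) ?_
    rw [hr2, div_le_one (by positivity), ht, scale, ← hr, div_pow, one_pow, mul_one_div,
      le_div_iff₀ (by positivity), ← pow_mul, ← pow_mul, ← pow_add]
    exact pow_le_pow_right₀ hr1 (by omega)
  have ha : 0 ≤ ∫ ω, d (enc e ω) ^ p ∂P := integral_nonneg fun ω => heven.pow_nonneg _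
  have h2p : 0 ≤ (2 : ℝ) ^ p * (2 ^ p * (2 * K)) * t * ∫ ω, d (enc e ω) ^ p ∂P := by positivity
  have h2q : 0 ≤ (2 : ℝ) ^ p * t := by positivity
  calc _ ≤ (1 + 2 ^ p * t) * ∫ ω, d (enc e ω) ^ p ∂P + 2 ^ p * (2 ^ p * (2 * K)) * t + 1 := by
        linarith
    _ ≤ _ := by
        simp only [hd] at ha h2p ⊢
        nlinarith

/-- The even moments of the increments of normalized urn functionals are uniformly small. -/
theorem exists_moment_bound (k : ℕ) : ∃ η : ℕ → ℝ, Tendsto η atTop (𝓝 0) ∧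
    ∀ {Ω : Type*} [MeasurableSpace Ω] {P : Measure Ω} [IsProbabilityMeasure P]
      {e : (k : ℕ) → Ω → Fin (k + 1)}, IsRRTProcess e P →
      ∀ {Q : ℕ → Encoding → ℝ} {q : ℕ → ℕ → Encoding → ℝ}, IsUrn Q q → ∀ {m n : ℕ}, m ≤ n →
        ∫ ω, (ratio Q n (enc e ω) - ratio Q m (enc e ω)) ^ (2 * (k + 2)) ∂P ≤ η m := by
  obtain ⟨K, hK0, hK⟩ := exists_incBound_pow_le (2 * (k + 2))
  set c : ℝ := 2 ^ (2 * (k + 2)) * (1 + 2 ^ (2 * (k + 2)) * (2 * K)) with hc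
  have hc0 : 0 ≤ c := by positivity
  -- At `n = m` the moment plus one equals 1, and each later factor `1 + c * scale j` is at most its
  -- exponential. The tail of the convergent series tends to 0.
  refine ⟨fun m => Real.exp (c * ∑' j, scale (j + m)) - 1, ?_, ?_⟩
  · have h1 : Tendsto (fun m => c * ∑' j, scale (j + m)) atTop (𝓝 (c * 0)) :=
      (tendsto_sum_nat_add scale).const_mul c
    have h2 := ((Real.continuous_exp.tendsto _).comp h1).sub_const 1
    simpa using h2
  · intro Ω _ P _ e he Q q h m n hmn
    have h1 : ∀ l, ∫ ω, (ratio Q (m + l) (enc e ω) - ratio Q m (enc e ω)) ^ (2 * (k + 2)) ∂P + 1 ≤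
        Real.exp (c * ∑ j ∈ Finset.range l, scale (j + m)) := by
      intro l
      induction l with
      | zero => simp
      | succ l ih =>
        refine (h.integral_pow_succ_le he hK0 hK (Nat.le_add_right m l)).trans ?_
        rw [Finset.sum_range_succ, mul_add c, Real.exp_add]
        have h3 := scale_pos (m + l)
        rw [← hc, add_comm l m, add_comm (1 : ℝ)]
        exact mul_le_mul ih (Real.add_one_le_exp _) (by positivity) (Real.exp_pos _).le
    obtain ⟨l, rfl⟩ := Nat.exists_eq_add_of_le hmn
    have h2 : Real.exp (c * ∑ j ∈ Finset.range l, scale (j + m)) ≤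
        Real.exp (c * ∑' j, scale (j + m)) := by
      refine Real.exp_le_exp.2 (mul_le_mul_of_nonneg_left ?_ hc0)
      exact ((summable_nat_add_iff m).2 summable_scale).sum_le_tsum _
        fun j _ => (scale_pos _).le
    linarith [h1 l]

end IsUrn

/-! ### First exit from the nodes of small norm -/

/-- The shortest prefix `v` of a word with `k ≤ |v|₁`, or the word itself if there is none. -/
def exit : ℕ → Node → Node
  | _, [] => []
  | k, a :: t => if k = 0 then [] else a :: exit (k - a) t

theorem exit_zero (w : Node) : exit 0 w = [] := by
  cases w <;> simp [exit]

theorem exit_prefix (k : ℕ) (w : Node) : exit k w <+: w := by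
  induction w generalizing k with
  | nil => simp [exit]
  | cons a t ih =>
    rw [exit]
    split_ifs
    · exact List.nil_prefix
    · exact (List.cons_prefix_cons).2 ⟨rfl, ih _⟩

theorem norm1_cons (a : ℕ+) (t : Node) : norm1 (a :: t) = a + norm1 t := by
  simp [norm1]

theorem exit_of_norm1_lt {k : ℕ} {w : Node} (h : norm1 w < k) : exit k w = w := by
  induction w generalizing k with
  | nil => simp [exit]
  | cons a t ih =>
    rw [norm1_cons] at h
    rw [exit, if_neg (by omega), ih (by omega)]

theorem exit_snoc (k : ℕ) (w : Node) (a : ℕ+) :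
    exit k (w ++ [a]) = if k ≤ norm1 w then exit k w else w ++ [a] := by
  induction w generalizing k with
  | nil =>
    have h : norm1 [] = 0 := rfl
    rw [List.nil_append, h]
    by_cases hk : k = 0 <;> simp [exit, hk]
  | cons b t ih =>
    rw [List.cons_append, exit, exit, ih, norm1_cons]
    by_cases hk : k = 0
    · simp [hk]
    · rw [if_neg hk, if_neg hk]
      by_cases h : k ≤ b + norm1 t
      · rw [if_pos h, if_pos (show k - b ≤ norm1 t by omega)]
      · rw [if_neg h, if_neg (show ¬ k - b ≤ norm1 t by omega)]

theorem le_norm1_exit {k : ℕ} {w : Node} (h : k ≤ norm1 w) : k ≤ norm1 (exit k w) := by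
  induction w generalizing k with
  | nil => simpa [exit] using h
  | cons a t ih =>
    rw [norm1_cons] at h
    rw [exit]
    split_ifs with hk
    · omega
    · rw [norm1_cons]
      have := ih (k := k - a) (by omega)
      omega

theorem exit_of_prefix {k : ℕ} {v w : Node} (hv : k ≤ norm1 v) (h : v <+: w) :
    exit k w = exit k v := by
  obtain ⟨t, rfl⟩ := h
  induction t using List.reverseRecOn with
  | nil => rw [List.append_nil]
  | append_singleton t a ih =>
    rw [← List.append_assoc, exit_snoc, if_pos (by rw [norm1_append]; omega), ih]

/-- The subtrees rooted at exit nodes partition the words of norm at least `k`: lying below an exit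
node means exiting there. -/
theorem exit_prefix_iff {k : ℕ} {w w' : Node} (h : k ≤ norm1 w) :
    exit k w <+: w' ↔ k ≤ norm1 w' ∧ exit k w' = exit k w := by
  have h1 := le_norm1_exit h
  constructor
  · intro hp
    refine ⟨h1.trans (norm1_le_of_prefix hp), ?_⟩
    rw [exit_of_prefix h1 hp, ← exit_of_prefix h1 (exit_prefix k w)]
  · rintro ⟨-, h2⟩
    rw [← h2]
    exact exit_prefix k w'

theorem mem_nodesUpTo {k : ℕ} {u : Node} : u ∈ nodesUpTo k ↔ norm1 u ≤ k := by
  simp [nodesUpTo]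

theorem subsingleton_child (u w : Node) : {i : ℕ+ | u ++ [i] <+: w}.Subsingleton := by
  intro i hi j hj
  have h := (List.prefix_of_prefix_length_le hi hj (by simp)).eq_of_length (by simp)
  simpa using h

theorem summable_child (u w : Node) (F : ℕ+ → ℝ) :
    Summable (fun i : ℕ+ => if u ++ [i] <+: w then F i else 0) := by
  refine summable_of_hasFiniteSupport ((subsingleton_child u w).finite.subset fun i hi => ?_)
  by_contra h
  exact hi (if_neg h)

/-- Appending a letter `a` to `w` creates just one new prefix, `w ++ [a]`, and this is a child of
`u` only for `u = w`. -/
theorem tsum_child_snoc (u w : Node) (a : ℕ+) (F : ℕ+ → ℝ) :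
    ∑' i : ℕ+, (if u ++ [i] <+: w ++ [a] then F i else 0) =
      ∑' i : ℕ+, (if u ++ [i] <+: w then F i else 0) + if u = w then F a else 0 := by
  have h2 : ∀ i : ℕ+, (if u ++ [i] <+: w ++ [a] then F i else 0) =
      (if u ++ [i] <+: w then F i else 0) + if i = a then (if u = w then F a else 0) else 0 := by
    intro i
    by_cases hu : u = w
    · subst hu
      have h3 : ¬ u ++ [i] <+: u := fun h => by
        have := h.length_le
        simp at this
      by_cases hi : i = a
      · subst hi
        simp [h3]
      · have h4 : ¬ u ++ [i] <+: u ++ [a] := by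
          rw [snoc_prefix_snoc_iff]
          tauto
        simp [h3, h4, hi]
    · have h4 : u ++ [i] <+: w ++ [a] ↔ u ++ [i] <+: w := by
        rw [snoc_prefix_snoc_iff]
        tauto
      simp only [h4, if_neg hu, ite_self, add_zero]
  rw [tsum_congr h2, (summable_child u w _).tsum_add ((hasSum_ite_eq a _).summable), tsum_ite_eq]

/-- Telescoping along the prefixes of `w` up to the first exit. -/
theorem sum_nodesUpTo_tsum_child (k : ℕ) (f : Node → ℝ) (w : Node) :
    ∑ u ∈ nodesUpTo k, ∑' i : ℕ+, (if u ++ [i] <+: w then f (u ++ [i]) - f u else 0) =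
      f (exit (k + 1) w) - f [] := by
  induction w using List.reverseRecOn with
  | nil => simp [exit]
  | append_singleton w a ih =>
    simp only [tsum_child_snoc _ w a fun i => f (_ ++ [i]) - f _]
    rw [Finset.sum_add_distrib, ih, Finset.sum_ite_eq', exit_snoc]
    by_cases hk : norm1 w ≤ k
    · rw [if_pos (mem_nodesUpTo.2 hk), if_neg (by omega), exit_of_norm1_lt (by omega)]
      ring
    · rw [if_neg (by rw [mem_nodesUpTo]; exact hk), if_pos (by omega)]
      ring

/-! ### The two functionals -/

/-- The contribution of node `j` to the path length functional of the subtrees that are rooted at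
the exit nodes. -/
noncomputable def pathInc (k n j : ℕ) (x : Encoding) : ℝ :=
  if k ≤ norm1 (word x j) then
    (word x j).length + 1 - (exit k (word x j)).length - (harmonic (cnt x n (exit k (word x j))) : ℝ)
  else 0

/-- The contribution of node `j` to the difference of horizontal and standard path length of the
subtrees that are rooted at the exit nodes. -/
noncomputable def widthInc (k n j : ℕ) (x : Encoding) : ℝ :=
  if k ≤ norm1 (word x j) then
    (norm1 (word x j) - norm1 (exit k (word x j))) -
      2 * ((word x j).length - (exit k (word x j)).length) + deg x n j
  else 0

theorem harmonic_mono {a b : ℕ} (h : a ≤ b) : (harmonic a : ℝ) ≤ harmonic b := by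
  unfold harmonic
  push_cast
  exact Finset.sum_le_sum_of_subset_of_nonneg (Finset.range_subset_range.2 h)
    fun _ _ _ => by positivity

/-- If the new node joins an exit subtree of size `m`, each of the `m` old nodes there loses `1 / (m
+ 1)` through the harmonic number. The new node has relative depth one more than its parent, and the
net gain is exactly the parent's value. A new exit node contributes `1 - harmonic 1 = 0`. -/
theorem sum_pathInc_succ (k n : ℕ) (x : Encoding) :
    ∑ j ∈ Finset.range (n + 2), pathInc k (n + 1) j x =
      ∑ j ∈ Finset.range (n + 1), pathInc k n j x + pathInc k n (x n) x := by
  rw [Finset.sum_range_succ]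
  have hnew := cnt_word_succ x n
  by_cases hk : k ≤ norm1 (word x (x n))
  · set v := exit k (word x (x n)) with hv
    have hexit : exit k (word x (n + 1)) = v := by
      rw [word_succ, exit_snoc, if_pos hk]
    have hk' : k ≤ norm1 (word x (n + 1)) := by
      rw [norm1_word_succ]
      omega
    set m := cnt x n v with hm
    have hcnt : cnt x (n + 1) v = m + 1 := by
      rw [cnt_succ, if_pos (by rw [← hexit]; exact exit_prefix _ _)]
    have h1 : ∀ j ∈ Finset.range (n + 1), pathInc k (n + 1) j x =
        pathInc k n j x - if v <+: word x j then (1 : ℝ) / (m + 1) else 0 := by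
      intro j _
      unfold pathInc
      by_cases hj : k ≤ norm1 (word x j)
      · rw [if_pos hj, if_pos hj, cnt_succ]
        have h2 : exit k (word x j) <+: word x (n + 1) ↔ v = exit k (word x j) := by
          rw [exit_prefix_iff hj, hexit]
          tauto
        have h3 : v <+: word x j ↔ v = exit k (word x j) := by
          rw [hv, exit_prefix_iff hk]
          tauto
        by_cases h4 : v = exit k (word x j)
        · rw [if_pos (h2.2 h4), if_pos (h3.2 h4), ← h4, harmonic_succ]
          push_cast
          rw [one_div]
          ring
        · rw [if_neg fun h => h4 (h2.1 h), if_neg fun h => h4 (h3.1 h), add_zero, sub_zero]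
      · have h3 : ¬ v <+: word x j := by
          rw [hv, exit_prefix_iff hk]
          tauto
        rw [if_neg hj, if_neg hj, if_neg h3, sub_zero]
    rw [Finset.sum_congr rfl h1, Finset.sum_sub_distrib]
    have h5 : ∑ j ∈ Finset.range (n + 1), (if v <+: word x j then (1 : ℝ) / (m + 1) else 0) =
        m / (m + 1) := by
      rw [hm, cnt_eq_sum, Finset.sum_div]
      refine Finset.sum_congr rfl fun j _ => ?_
      split_ifs <;> simp
    rw [h5, pathInc, pathInc, if_pos hk, if_pos hk', hexit, hcnt, length_word_succ, harmonic_succ]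
    push_cast
    field_simp
    ring
  -- The parent has norm below `k`, so the new node lies in none of the existing exit subtrees.
  · have h1 : ∀ j ∈ Finset.range (n + 1), pathInc k (n + 1) j x = pathInc k n j x := by
      intro j hj'
      unfold pathInc
      by_cases hj : k ≤ norm1 (word x j)
      · have h2 : ¬ exit k (word x j) <+: word x (n + 1) := by
          rw [exit_prefix_iff hj]
          rintro ⟨-, h3⟩
          rw [word_succ, exit_snoc, if_neg hk, ← word_succ] at h3
          refine not_word_prefix_of_lt x (Finset.mem_range.1 hj') ?_
          rw [h3]
          exact exit_prefix _ _
        rw [cnt_succ, if_neg h2, add_zero]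
      · rw [if_neg hj, if_neg hj]
    rw [Finset.sum_congr rfl h1]
    congr 1
    rw [pathInc, pathInc, if_neg hk]
    split_ifs with h2
    · rw [word_succ, exit_snoc, if_neg hk, ← word_succ, cnt_succ, hnew, if_pos List.prefix_rfl]
      simp
    · rfl

/-- The parent's degree rises by one, while the new node's value is the parent's old value minus
one. A new exit node contributes 0. -/
theorem sum_widthInc_succ (k n : ℕ) (x : Encoding) :
    ∑ j ∈ Finset.range (n + 2), widthInc k (n + 1) j x =
      ∑ j ∈ Finset.range (n + 1), widthInc k n j x + widthInc k n (x n) x := by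
  rw [sum_range_update n (x n) (Nat.lt_succ_iff.1 (x n).isLt) (fun j => widthInc k n j x) _
    fun j _ hj => by
      rw [widthInc, widthInc, deg_succ, if_neg (Ne.symm hj), add_zero]]
  rw [add_assoc]
  congr 1
  unfold widthInc
  rw [deg_succ, if_pos rfl, deg_eq_zero x le_rfl]
  by_cases hk : k ≤ norm1 (word x (x n))
  · have hexit : exit k (word x (n + 1)) = exit k (word x (x n)) := by
      rw [word_succ, exit_snoc, if_pos hk]
    have hk' : k ≤ norm1 (word x (n + 1)) := by
      rw [norm1_word_succ]
      omega
    rw [if_pos hk, if_pos hk, if_pos hk', hexit, length_word_succ, norm1_word_succ]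
    push_cast
    ring
  · rw [if_neg hk, if_neg hk]
    split_ifs with h2
    · rw [word_succ, exit_snoc, if_neg hk]
      simp
    · simp

/-- The path length functional of the subtrees rooted at the exit nodes. -/
noncomputable def pathSum (k n : ℕ) (x : Encoding) : ℝ :=
  ∑ j ∈ Finset.range (n + 1), pathInc k n j x

/-- The horizontal minus standard path length functional of the subtrees rooted at the exit
nodes. -/
noncomputable def widthSum (k n : ℕ) (x : Encoding) : ℝ :=
  ∑ j ∈ Finset.range (n + 1), widthInc k n j x

theorem isUrn_pathSum (k : ℕ) : IsUrn (pathSum k) (pathInc k) where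
  dep n j hj x y hxy := by
    unfold pathInc
    rw [word_congr hxy hj, cnt_congr hxy]
  sum n x := rfl
  step n x := sum_pathInc_succ k n x
  bound n x j hj := by
    have h0 := incBound_nonneg x n j
    unfold pathInc
    split_ifs
    · have h1 : ((exit k (word x j)).length : ℝ) ≤ (word x j).length := by
        exact_mod_cast (exit_prefix k (word x j)).length_le
      have h2 : ((word x j).length : ℝ) ≤ height x n j := by
        have := length_le_norm1 (word x j)
        unfold height
        exact_mod_cast (by omega : (word x j).length ≤ norm1 (word x j) + deg x n j)
      have h3 := harmonic_nonneg (cnt x n (exit k (word x j)))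
      have h4 := harmonic_mono (cnt_le x n (exit k (word x j)))
      have h5 : (0 : ℝ) ≤ (exit k (word x j)).length := by positivity
      unfold incBound
      rw [abs_le]
      constructor <;> linarith
    · rw [abs_zero]
      exact h0

theorem isUrn_widthSum (k : ℕ) : IsUrn (widthSum k) (widthInc k) where
  dep n j hj x y hxy := by
    unfold widthInc
    rw [word_congr hxy hj, deg_congr hxy]
  sum n x := rfl
  step n x := sum_widthInc_succ k n x
  bound n x j hj := by
    have h0 := incBound_nonneg x n j
    unfold widthInc
    split_ifs
    · obtain ⟨t, ht⟩ := exit_prefix k (word x j)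
      have h1 : (norm1 (word x j) : ℝ) = norm1 (exit k (word x j)) + norm1 t := by
        have := norm1_append (exit k (word x j)) t
        rw [ht] at this
        exact_mod_cast this
      have h2 : ((word x j).length : ℝ) = (exit k (word x j)).length + t.length := by
        have := List.length_append (as := exit k (word x j)) (bs := t)
        rw [ht] at this
        exact_mod_cast this
      have h3 : (t.length : ℝ) ≤ norm1 t := by exact_mod_cast length_le_norm1 t
      have h4 := harmonic_nonneg (n + 1)
      have h5 : (0 : ℝ) ≤ norm1 (exit k (word x j)) := by positivity
      have h6 : (0 : ℝ) ≤ deg x n j := by positivity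
      have h7 : (0 : ℝ) ≤ t.length := by positivity
      unfold incBound height
      push_cast
      rw [abs_le]
      constructor <;> linarith
    · rw [abs_zero]
      exact h0

theorem pathSum_eq_zero {k n : ℕ} (h : n < k) (x : Encoding) : pathSum k n x = 0 :=
  Finset.sum_eq_zero fun j hj => by
    have := norm1_word_le x j
    rw [Finset.mem_range] at hj
    rw [pathInc, if_neg (by omega)]

theorem widthSum_eq_zero {k n : ℕ} (h : n < k) (x : Encoding) : widthSum k n x = 0 :=
  Finset.sum_eq_zero fun j hj => by
    have := norm1_word_le x j
    rw [Finset.mem_range] at hj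
    rw [widthInc, if_neg (by omega)]

/-- At level 0 the only exit node is the root. The degrees sum to `n` and the constants `1 -
harmonic (n + 1)` to their multiple by `n + 1`, which yields the centring. -/
theorem HPL_harrisTree (n : ℕ) (x : Encoding) :
    HPL (harrisTree x (n + 1)) = pathSum 0 n x + widthSum 0 n x +
      ((n : ℝ) + 1) * harmonic (n + 1) - 2 * (n + 1) + 1 := by
  unfold HPL
  rw [sum_harrisTree, pathSum, widthSum, ← Finset.sum_add_distrib]
  have h1 : ∀ j ∈ Finset.range (n + 1), pathInc 0 n j x + widthInc 0 n j x =
      ((norm1 (word x j) : ℝ) - (word x j).length) + (1 - (harmonic (n + 1) : ℝ)) + deg x n j := by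
    intro j _
    have h : norm1 [] = 0 := rfl
    rw [pathInc, widthInc, if_pos (Nat.zero_le _), if_pos (Nat.zero_le _), exit_zero, cnt_nil, h]
    push_cast [List.length_nil]
    ring
  have h2 : ∑ j ∈ Finset.range (n + 1), (deg x n j : ℝ) = n := by exact_mod_cast sum_deg x n
  rw [Finset.sum_congr rfl h1, Finset.sum_add_distrib, Finset.sum_add_distrib, h2,
    Finset.sum_const, Finset.card_range, nsmul_eq_mul]
  push_cast
  ring

theorem sum_nodesUpTo_tsum_cnt (k n : ℕ) (x : Encoding) (f : Node → ℝ) :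
    ∑ u ∈ nodesUpTo k, ∑' i : ℕ+, (cnt x n (u ++ [i]) : ℝ) * (f (u ++ [i]) - f u) =
      ∑ j ∈ Finset.range (n + 1), (f (exit (k + 1) (word x j)) - f []) := by
  have h1 : ∀ u : Node, ∑' i : ℕ+, (cnt x n (u ++ [i]) : ℝ) * (f (u ++ [i]) - f u) =
      ∑ j ∈ Finset.range (n + 1),
        ∑' i : ℕ+, (if u ++ [i] <+: word x j then f (u ++ [i]) - f u else 0) := by
    intro u
    rw [← Summable.tsum_finsetSum fun j _ => summable_child u (word x j) _]
    refine tsum_congr fun i => ?_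
    rw [cnt_eq_sum, Finset.sum_mul]
    exact Finset.sum_congr rfl fun j _ => by split_ifs <;> simp
  simp only [h1]
  rw [Finset.sum_comm]
  exact Finset.sum_congr rfl fun j _ => sum_nodesUpTo_tsum_child k f (word x j)

theorem sum_nodesUpTo_word (k n : ℕ) (x : Encoding) (g : ℕ → ℝ) :
    ∑ u ∈ nodesUpTo k, ∑ j ∈ Finset.range (n + 1), (if word x j = u then g j else 0) =
      ∑ j ∈ Finset.range (n + 1), if norm1 (word x j) ≤ k then g j else 0 := by
  rw [Finset.sum_comm]
  refine Finset.sum_congr rfl fun j _ => ?_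
  rw [Finset.sum_ite_eq]
  simp only [mem_nodesUpTo]

/-- The toll of the path length functional at `u`. -/
noncomputable def pathToll (n : ℕ) (u : Node) (x : Encoding) : ℝ :=
  ∑' i : ℕ+, (cnt x n (u ++ [i]) : ℝ) *
      (1 + (harmonic (cnt x n (u ++ [i])) : ℝ) - harmonic (cnt x n u)) +
    ∑ j ∈ Finset.range (n + 1), if word x j = u then 1 - (harmonic (cnt x n u) : ℝ) else 0

/-- The toll of the width functional at `u`. -/
noncomputable def widthToll (n : ℕ) (u : Node) (x : Encoding) : ℝ :=
  ∑' i : ℕ+, (cnt x n (u ++ [i]) : ℝ) * ((i : ℝ) - 2) +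
    ∑ j ∈ Finset.range (n + 1), if word x j = u then (deg x n j : ℝ) else 0

/-- Telescope `|u| + harmonic (cnt x n u)` along the prefixes of each word up to its exit. A word
with `|u|₁ ≤ k` never exits, and its leftover `1 - harmonic (cnt x n u)` is the second part of the
toll at `u`. -/
theorem pathSum_zero_sub (k n : ℕ) (x : Encoding) :
    pathSum 0 n x - pathSum (k + 1) n x = ∑ u ∈ nodesUpTo k, pathToll n u x := by
  set f : Node → ℝ := fun u => u.length + harmonic (cnt x n u) with hf
  have h1 : ∀ u, pathToll n u x =
      ∑' i : ℕ+, (cnt x n (u ++ [i]) : ℝ) * (f (u ++ [i]) - f u) +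
      ∑ j ∈ Finset.range (n + 1),
        if word x j = u then 1 - (harmonic (cnt x n (word x j)) : ℝ) else 0 := by
    intro u
    unfold pathToll
    congr 1
    · refine tsum_congr fun i => ?_
      simp only [hf]
      push_cast [List.length_append, List.length_singleton]
      ring
    · refine Finset.sum_congr rfl fun j _ => ?_
      split_ifs with h
      · rw [h]
      · rfl
  simp only [h1]
  rw [Finset.sum_add_distrib, sum_nodesUpTo_tsum_cnt,
    sum_nodesUpTo_word k n x fun j => 1 - (harmonic (cnt x n (word x j)) : ℝ), pathSum, pathSum,
    ← Finset.sum_sub_distrib, ← Finset.sum_add_distrib]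
  refine Finset.sum_congr rfl fun j _ => ?_
  rw [pathInc, pathInc, if_pos (Nat.zero_le _), exit_zero]
  by_cases hk : norm1 (word x j) ≤ k
  · rw [if_neg (by omega), if_pos hk, exit_of_norm1_lt (by omega)]
    simp only [hf, List.length_nil]
    push_cast
    ring
  · rw [if_pos (by omega), if_neg hk]
    simp only [hf, List.length_nil]
    push_cast
    ring

/-- The same telescoping with `|u|₁ - 2|u|`; here the leftover of a word that never exits is the
degree of its node. -/
theorem widthSum_zero_sub (k n : ℕ) (x : Encoding) :
    widthSum 0 n x - widthSum (k + 1) n x = ∑ u ∈ nodesUpTo k, widthToll n u x := by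
  set f : Node → ℝ := fun u => norm1 u - 2 * u.length with hf
  have h0 : norm1 [] = 0 := rfl
  have h1 : ∀ u, widthToll n u x =
      ∑' i : ℕ+, (cnt x n (u ++ [i]) : ℝ) * (f (u ++ [i]) - f u) +
      ∑ j ∈ Finset.range (n + 1), if word x j = u then (deg x n j : ℝ) else 0 := by
    intro u
    unfold widthToll
    congr 1
    refine tsum_congr fun i => ?_
    simp only [hf, norm1_append, norm1_singleton]
    push_cast [List.length_append, List.length_singleton]
    ring
  simp only [h1]
  rw [Finset.sum_add_distrib, sum_nodesUpTo_tsum_cnt,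
    sum_nodesUpTo_word k n x fun j => (deg x n j : ℝ), widthSum, widthSum,
    ← Finset.sum_sub_distrib, ← Finset.sum_add_distrib]
  refine Finset.sum_congr rfl fun j _ => ?_
  rw [widthInc, widthInc, if_pos (Nat.zero_le _), exit_zero]
  by_cases hk : norm1 (word x j) ≤ k
  · rw [if_neg (by omega), if_pos hk, exit_of_norm1_lt (by omega)]
    simp only [hf, List.length_nil, h0]
    push_cast
    ring
  · rw [if_pos (by omega), if_neg hk]
    simp only [hf, List.length_nil, h0]
    push_cast
    ring

/-! ### Almost sure properties of the chain -/

section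

variable {Ω : Type*} [MeasurableSpace Ω] {P : Measure Ω} [IsProbabilityMeasure P]
  {e : (k : ℕ) → Ω → Fin (k + 1)}

theorem submartingale_ratio (he : IsRRTProcess e P) (Q : ℕ → Encoding → ℝ)
    (q : ℕ → ℕ → Encoding → ℝ) (hQ : ∀ n, DependsBelow n (Q n))
    (hq : ∀ n, ∀ j ≤ n, DependsBelow n (q n j))
    (hstep : ∀ n x, Q n x + q n (x n) x ≤ Q (n + 1) x)
    (hsum : ∀ n x, Q n x ≤ ∑ j ∈ Finset.range (n + 1), q n j x) :
    Submartingale (fun n ω => IsUrn.ratio Q n (enc e ω)) (past e he.measurable) P := by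
  refine submartingale_of_step he (IsUrn.ratio Q) (fun n => (hQ n).comp fun y => y / ((n : ℝ) + 1))
    (fun n j x => (Q n x + q n j x) / (n + 2)) (fun n j hj x y hxy => ?_) (fun n x => ?_)
    fun n x => ?_
  · simp only
    rw [hQ n x y hxy, hq n j hj x y hxy]
  · unfold IsUrn.ratio
    have h1 : (((n + 1 : ℕ) : ℝ) + 1) = n + 2 := by
      push_cast
      ring
    rw [h1]
    gcongr
    exact hstep n x
  · unfold IsUrn.ratio
    rw [← Finset.sum_div, Finset.sum_add_distrib, Finset.sum_const, Finset.card_range,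
      nsmul_eq_mul]
    have h1 : Q n x = ((n : ℝ) + 2) * Q n x / (n + 2) := by
      field_simp
    have h2 : ((n : ℝ) + 2) * Q n x ≤
        (((n + 1 : ℕ) : ℝ) * Q n x + ∑ j ∈ Finset.range (n + 1), q n j x) := by
      push_cast
      linarith [hsum n x]
    gcongr
    calc Q n x = ((n : ℝ) + 2) * Q n x / (n + 2) := h1
      _ ≤ _ := by gcongr

theorem dependsBelow_cnt (n : ℕ) (u : Node) : DependsBelow n (fun x => cnt x n u) :=
  fun _ _ h => cnt_congr h u

theorem dependsBelow_word {n j : ℕ} (hj : j ≤ n) : DependsBelow n (fun x => word x j) :=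
  fun _ _ h => word_congr h hj

/-- A Pólya urn: the subtree of `u` grows when the chosen parent lies in it. The birth of `u` adds
one extra unit, so the proportion is a submartingale with values in `[0, 1]`. -/
theorem ae_exists_tendsto_cnt (he : IsRRTProcess e P) :
    ∀ᵐ ω ∂P, ∀ u, ∃ c, Tendsto (fun n : ℕ => (cnt (enc e ω) n u : ℝ) / (n + 1)) atTop (𝓝 c) := by
  rw [ae_all_iff]
  intro u
  have h := submartingale_ratio he (fun n x => (cnt x n u : ℝ))
    (fun n j x => if u <+: word x j then 1 else 0)
    (fun n => (dependsBelow_cnt n u).comp fun k => (k : ℝ))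
    (fun n j hj => (dependsBelow_word hj).comp fun w => if u <+: w then (1 : ℝ) else 0)
    (fun n x => ?_) (fun n x => (cnt_eq_sum x n u).le)
  · refine ae_exists_tendsto_of_submartingale h (K := 1) fun n => ?_
    have h1 : ∀ ω, |IsUrn.ratio (fun n x => (cnt x n u : ℝ)) n (enc e ω)| ≤ 1 := by
      intro ω
      unfold IsUrn.ratio
      rw [abs_of_nonneg (by positivity), div_le_one (by positivity)]
      have h2 : (cnt (enc e ω) n u : ℝ) ≤ ((n + 1 : ℕ) : ℝ) := Nat.cast_le.2 (cnt_le _ n u)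
      push_cast at h2
      exact h2
    calc _ ≤ ∫ _, (1 : ℝ) ∂P := integral_mono (h.integrable n).abs (integrable_const _) h1
      _ = 1 := by simp
  · rw [cnt_succ]
    push_cast
    gcongr
    by_cases h : u <+: word x (x n)
    · rw [if_pos h, if_pos]
      rw [word_succ]
      exact h.trans (List.prefix_append _ _)
    · rw [if_neg h]
      split_ifs <;> norm_num

/-! ### Geometric decay of the subtree sizes of siblings. -/

/-- The geometric weight of node `j` among the descendants of `u`. -/
noncomputable def childInc (u : Node) (n j : ℕ) (x : Encoding) : ℝ :=
  ∑' i : ℕ+, (if u ++ [i] <+: word x j then (3 / 2 : ℝ) ^ (i : ℕ) else 0) +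
    if word x j = u then 3 * (3 / 2 : ℝ) ^ deg x n j else 0

/-- The geometrically weighted sizes of the subtrees of the children of `u`, together with a
geometric weight of the number of children. -/
noncomputable def childSum (u : Node) (n : ℕ) (x : Encoding) : ℝ :=
  ∑ j ∈ Finset.range (n + 1), childInc u n j x

theorem childInc_nonneg (u : Node) (n j : ℕ) (x : Encoding) : 0 ≤ childInc u n j x := by
  refine add_nonneg (tsum_nonneg fun i => ?_) ?_
  · split_ifs <;> positivity
  · split_ifs <;> positivity

theorem childSum_nonneg (u : Node) (n : ℕ) (x : Encoding) : 0 ≤ childSum u n x :=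
  Finset.sum_nonneg fun j _ => childInc_nonneg u n j x

/-- The constant 3 solves `r + c * (r - 1) = c` for `r = 3 / 2`. When `u` of degree `d` is chosen,
the new child's weight `r ^ (d + 1)` and the increase of `c * r ^ d` then add up to `c * r ^ d`. The
last summand is the birth of `u`. -/
theorem childSum_succ (u : Node) (n : ℕ) (x : Encoding) :
    childSum u (n + 1) x = childSum u n x + childInc u n (x n) x +
      if word x (n + 1) = u then 3 else 0 := by
  unfold childSum
  rw [sum_range_update n (x n) (Nat.lt_succ_iff.1 (x n).isLt) (fun j => childInc u n j x) _
    fun j _ hj => by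
      rw [childInc, childInc, deg_succ, if_neg (Ne.symm hj), add_zero]]
  unfold childInc
  rw [deg_succ, if_pos rfl, deg_eq_zero x le_rfl]
  simp only [pow_zero, mul_one]
  rw [show (∑' i : ℕ+, if u ++ [i] <+: word x (n + 1) then (3 / 2 : ℝ) ^ (i : ℕ) else 0) =
      ∑' i : ℕ+, (if u ++ [i] <+: word x (x n) then (3 / 2 : ℝ) ^ (i : ℕ) else 0) +
        if u = word x (x n) then (3 / 2 : ℝ) ^ (deg x n (x n) + 1) else 0 by
    rw [word_succ, tsum_child_snoc, Nat.succPNat_coe]]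
  by_cases h : word x (x n) = u
  · rw [if_pos h, if_pos h, if_pos h.symm, pow_succ]
    ring
  · rw [if_neg h, if_neg h, if_neg (Ne.symm h)]
    ring

theorem dependsBelow_childInc (u : Node) {n j : ℕ} (hj : j ≤ n) :
    DependsBelow n (childInc u n j) := by
  intro x y h
  unfold childInc
  rw [word_congr h hj, deg_congr h]

theorem dependsBelow_childSum (u : Node) (n : ℕ) : DependsBelow n (childSum u n) :=
  DependsBelow.sum fun j hj => dependsBelow_childInc u (by rw [Finset.mem_range] at hj; omega)

theorem integral_add_step (he : IsRRTProcess e P) (n : ℕ) {Q : Encoding → ℝ}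
    {q : ℕ → Encoding → ℝ} (hQ : DependsBelow n Q) (hq : ∀ j ≤ n, DependsBelow n (q j))
    (hsum : ∀ x, Q x = ∑ j ∈ Finset.range (n + 1), q j x) :
    ∫ ω, (Q (enc e ω) + q (e n ω) (enc e ω)) ∂P =
      ((n : ℝ) + 2) / (n + 1) * ∫ ω, Q (enc e ω) ∂P := by
  rw [integral_step he n (fun j x => Q x + q j x) fun j hj x y hxy => by
    simp only
    rw [hQ x y hxy, hq j hj x y hxy]]
  rw [← integral_const_mul]
  refine integral_congr_ae (Eventually.of_forall fun ω => ?_)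
  simp only
  rw [Finset.sum_add_distrib, ← hsum, Finset.sum_const, Finset.card_range, nsmul_eq_mul]
  push_cast
  field_simp
  ring

theorem dependsBelow_succ_apply {n : ℕ} {q : ℕ → Encoding → ℝ}
    (hq : ∀ j ≤ n, DependsBelow n (q j)) : DependsBelow (n + 1) (fun x => q (x n) x) := by
  intro x y hxy
  have hn := (x n).isLt
  simp only
  rw [← hxy n (by omega)]
  exact hq _ (by omega) _ _ fun k hk => hxy k (by omega)

/-- Apart from the birth of `u` the normalized mean is constant; the birth adds at most 3 times its
probability at that time. -/
theorem integral_childSum_le (he : IsRRTProcess e P) (u : Node) (n : ℕ) :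
    ∫ ω, IsUrn.ratio (childSum u) n (enc e ω) ∂P ≤
      3 * ∫ ω, ∑ j ∈ Finset.range (n + 1), (if word (enc e ω) j = u then (1 : ℝ) else 0) ∂P := by
  have hd : ∀ n, ∀ j ≤ n, DependsBelow n (fun x => if word x j = u then (1 : ℝ) else 0) :=
    fun n j hj => (dependsBelow_word hj).comp fun w => if w = u then (1 : ℝ) else 0
  induction n with
  | zero =>
    rw [← integral_const_mul]
    refine le_of_eq (integral_congr_ae (Eventually.of_forall fun ω => ?_))
    simp only [IsUrn.ratio, childSum, childInc, zero_add, Finset.sum_range_one, word_zero, deg]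
    simp
  | succ n ih =>
    have h1 : ∀ ω, IsUrn.ratio (childSum u) (n + 1) (enc e ω) =
        1 / ((n : ℝ) + 2) * (childSum u n (enc e ω) + childInc u n (e n ω) (enc e ω)) +
          3 / ((n : ℝ) + 2) * (if word (enc e ω) (n + 1) = u then (1 : ℝ) else 0) := by
      intro ω
      have hen : enc e ω n = e n ω := rfl
      unfold IsUrn.ratio
      rw [childSum_succ, hen]
      push_cast
      split_ifs
      · field_simp
        ring
      · field_simp
        ring
    have hi1 : Integrable
        (fun ω => childSum u n (enc e ω) + childInc u n (e n ω) (enc e ω)) P :=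
      ((dependsBelow_childSum u n).integrable he.measurable).add
        ((dependsBelow_succ_apply fun j hj => dependsBelow_childInc u hj).integrable he.measurable)
    have hi2 := (hd (n + 1) (n + 1) le_rfl).integrable (P := P) he.measurable
    have hi3 := (DependsBelow.sum (s := Finset.range (n + 1)) fun j hj =>
      hd n j (by rw [Finset.mem_range] at hj; omega)).integrable (P := P) he.measurable
    simp only [h1]
    rw [integral_add (hi1.const_mul _) (hi2.const_mul _), integral_const_mul, integral_const_mul,
      integral_add_step he n (dependsBelow_childSum u n) (fun j hj => dependsBelow_childInc u hj)
        fun x => rfl]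
    simp only [Finset.sum_range_succ _ (n + 1)]
    rw [integral_add hi3 hi2, mul_add]
    refine add_le_add ?_ ?_
    · refine le_trans (le_of_eq ?_) ih
      unfold IsUrn.ratio
      rw [integral_div]
      field_simp
    · have h0 : 0 ≤ ∫ ω, (if word (enc e ω) (n + 1) = u then (1 : ℝ) else 0) ∂P :=
        integral_nonneg fun ω => by
          simp only
          split_ifs <;> norm_num
      refine mul_le_mul_of_nonneg_right ?_ h0
      rw [div_le_iff₀ (by positivity)]
      linarith [(Nat.cast_nonneg n : (0 : ℝ) ≤ n)]

theorem sum_word_eq_le_one (x : Encoding) (u : Node) (s : Finset ℕ) :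
    ∑ j ∈ s, (if word x j = u then (1 : ℝ) else 0) ≤ 1 := by
  rw [Finset.sum_ite, Finset.sum_const_zero, add_zero, Finset.sum_const, nsmul_eq_mul, mul_one]
  have h : (s.filter fun j => word x j = u).card ≤ 1 := Finset.card_le_one.2 fun a ha b hb => by
    rw [Finset.mem_filter] at ha hb
    exact word_injective x (ha.2.trans hb.2.symm)
  exact_mod_cast h

theorem ae_exists_childSum_le (he : IsRRTProcess e P) :
    ∀ᵐ ω ∂P, ∀ u, ∃ K : ℝ, ∀ n : ℕ, childSum u n (enc e ω) ≤ K * (n + 1) := by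
  rw [ae_all_iff]
  intro u
  have h := submartingale_ratio he (childSum u) (childInc u) (dependsBelow_childSum u)
    (fun n j hj => dependsBelow_childInc u hj)
    (fun n x => by
      rw [childSum_succ]
      split_ifs <;> norm_num) fun n x => le_rfl
  have h1 := ae_exists_tendsto_of_submartingale h (K := 3) fun n => by
    have h2 : ∀ ω, |IsUrn.ratio (childSum u) n (enc e ω)| =
        IsUrn.ratio (childSum u) n (enc e ω) := fun ω =>
      abs_of_nonneg (div_nonneg (childSum_nonneg u n _) (by positivity))
    simp only [h2]
    refine (integral_childSum_le he u n).trans ?_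
    have hi := (DependsBelow.sum (n := n) (s := Finset.range (n + 1))
      (f := fun j x => if word x j = u then (1 : ℝ) else 0) fun j hj =>
      (dependsBelow_word (by rw [Finset.mem_range] at hj; omega)).comp
        fun w => if w = u then (1 : ℝ) else 0).integrable (P := P) he.measurable
    have h3 := integral_mono hi (integrable_const 1) fun ω => sum_word_eq_le_one (enc e ω) u _
    rw [integral_const, probReal_univ, one_smul] at h3
    linarith
  filter_upwards [h1] with ω ⟨c, hc⟩
  obtain ⟨K, hK⟩ := hc.bddAbove_range
  refine ⟨K, fun n => ?_⟩
  have := hK ⟨n, rfl⟩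
  simp only [IsUrn.ratio] at this
  rwa [div_le_iff₀ (by positivity)] at this

theorem le_childSum (x : Encoding) (n : ℕ) (u : Node) (i : ℕ+) :
    (cnt x n (u ++ [i]) : ℝ) * (3 / 2) ^ (i : ℕ) ≤ childSum u n x := by
  rw [cnt_eq_sum, Finset.sum_mul]
  refine Finset.sum_le_sum fun j _ => ?_
  have h1 : (if u ++ [i] <+: word x j then (1 : ℝ) else 0) * (3 / 2) ^ (i : ℕ) ≤
      ∑' i : ℕ+, (if u ++ [i] <+: word x j then (3 / 2 : ℝ) ^ (i : ℕ) else 0) := by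
    refine le_trans (le_of_eq ?_) ((summable_child u (word x j) _).le_tsum i fun i _ => ?_)
    · split_ifs <;> simp
    · split_ifs <;> positivity
  refine h1.trans (le_add_of_nonneg_right ?_)
  split_ifs <;> positivity

theorem pow_deg_le_childSum (x : Encoding) {n j : ℕ} (hj : j ≤ n) :
    (3 / 2 : ℝ) ^ deg x n j ≤ childSum (word x j) n x := by
  have h1 : childInc (word x j) n j x ≤ childSum (word x j) n x :=
    Finset.single_le_sum (f := fun i => childInc (word x j) n i x)
      (fun i _ => childInc_nonneg _ n i x) (Finset.mem_range.2 (by omega))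
  refine le_trans ?_ h1
  rw [childInc, if_pos rfl]
  have h2 : 0 ≤ ∑' i : ℕ+,
      (if word x j ++ [i] <+: word x j then (3 / 2 : ℝ) ^ (i : ℕ) else 0) :=
    tsum_nonneg fun i => by split_ifs <;> positivity
  have h3 : (0 : ℝ) < (3 / 2) ^ deg x n j := by positivity
  linarith

/-! ### Positivity of the limiting proportions. -/

/-- The harmonic potential of the subtree at `u`, started at time `t` if `u` is present then. -/
noncomputable def potential (u : Node) (t n : ℕ) (x : Encoding) : ℝ :=
  if t ≤ n ∧ 0 < cnt x t u then (harmonic n : ℝ) - harmonic (cnt x n u - 1) else 0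

/-- The potential after the step that chooses `j`. -/
noncomputable def potentialNext (u : Node) (t n j : ℕ) (x : Encoding) : ℝ :=
  if t ≤ n ∧ 0 < cnt x t u then
    potential u t n x + 1 / (n + 1) - (if u <+: word x j then 1 else 0) / cnt x n u
  else 0

theorem potential_nonneg (u : Node) (t n : ℕ) (x : Encoding) : 0 ≤ potential u t n x := by
  unfold potential
  split_ifs
  · rw [sub_nonneg]
    exact harmonic_mono (by have := cnt_le x n u; omega)
  · exact le_rfl

theorem potential_succ {u : Node} {t n : ℕ} (h : t ≤ n) (x : Encoding) :
    potential u t (n + 1) x = potentialNext u t n (x n) x := by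
  unfold potentialNext potential
  by_cases ht : 0 < cnt x t u
  · have hn : 0 < cnt x n u := ht.trans_le (cnt_mono x u h)
    rw [if_pos ⟨by omega, ht⟩, if_pos ⟨h, ht⟩, if_pos ⟨h, ht⟩, cnt_succ]
    have h1 : u <+: word x (n + 1) ↔ u <+: word x (x n) := by
      rw [word_succ, prefix_snoc_iff, ← word_succ]
      refine or_iff_right fun hu => ?_
      rw [hu, cnt_word_succ] at hn
      exact lt_irrefl _ hn
    obtain ⟨m, hm⟩ : ∃ m, cnt x n u = m + 1 := ⟨cnt x n u - 1, by omega⟩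
    rw [hm]
    by_cases h2 : u <+: word x (x n)
    · rw [if_pos (h1.2 h2), if_pos h2, Nat.add_sub_cancel, Nat.add_sub_cancel, harmonic_succ,
        harmonic_succ]
      push_cast
      rw [one_div, one_div]
      ring
    · rw [if_neg fun h => h2 (h1.1 h), if_neg h2, add_zero, harmonic_succ]
      push_cast
      rw [one_div]
      ring
  · rw [if_neg fun h => ht h.2, if_neg fun h => ht h.2]

theorem dependsBelow_potential (u : Node) (t n : ℕ) : DependsBelow n (potential u t n) := by
  intro x y h
  unfold potential
  by_cases ht : t ≤ n
  · rw [cnt_congr h, cnt_congr fun k hk => h k (by omega)]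
  · rw [if_neg fun h => ht h.1, if_neg fun h => ht h.1]

theorem dependsBelow_potentialNext (u : Node) (t : ℕ) {n j : ℕ} (hj : j ≤ n) :
    DependsBelow n (potentialNext u t n j) := by
  intro x y h
  unfold potentialNext
  by_cases ht : t ≤ n
  · rw [cnt_congr h, cnt_congr (n := t) fun k hk => h k (by omega), word_congr h hj,
      dependsBelow_potential u t n x y h]
  · rw [if_neg fun h => ht h.1, if_neg fun h => ht h.1]

/-- The increase `1 / (n + 1)` is offset by a decrease `1 / cnt` that occurs with probability `cnt /
(n + 1)`, so the potential is a martingale from time `t` on. -/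
theorem sum_potentialNext (u : Node) (t n : ℕ) (x : Encoding) :
    (∑ j ∈ Finset.range (n + 1), potentialNext u t n j x) / (n + 1) = potential u t n x := by
  unfold potentialNext
  by_cases ht : t ≤ n ∧ 0 < cnt x t u
  · have hn : 0 < cnt x n u := ht.2.trans_le (cnt_mono x u ht.1)
    simp only [if_pos ht]
    rw [Finset.sum_sub_distrib, Finset.sum_const, Finset.card_range, ← Finset.sum_div,
      ← cnt_eq_sum, nsmul_eq_mul, div_self (by positivity)]
    push_cast
    field_simp
    ring
  · simp only [if_neg ht]
    rw [potential, if_neg ht]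
    simp

theorem integral_potential_le (he : IsRRTProcess e P) (u : Node) (t n : ℕ) :
    ∫ ω, potential u t n (enc e ω) ∂P ≤ harmonic t := by
  rcases lt_or_ge n t with hn | hn
  · have h1 : ∀ ω, potential u t n (enc e ω) = 0 := fun ω => by
      rw [potential, if_neg fun h => by omega]
    simp only [h1, integral_zero]
    exact harmonic_nonneg t
  · induction n, hn using Nat.le_induction with
    | base =>
      have h1 : ∀ ω, potential u t t (enc e ω) ≤ harmonic t := fun ω => by
        unfold potential
        split_ifs
        · linarith [harmonic_nonneg (cnt (enc e ω) t u - 1)]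
        · exact harmonic_nonneg t
      have h2 := integral_mono ((dependsBelow_potential u t t).integrable (P := P) he.measurable)
        (integrable_const _) h1
      simpa using h2
    | succ n hn ih =>
      have h1 : ∀ ω, potential u t (n + 1) (enc e ω) =
          potentialNext u t n (e n ω) (enc e ω) := fun ω => potential_succ hn (enc e ω)
      simp only [h1]
      rw [integral_step he n (potentialNext u t n) fun j hj => dependsBelow_potentialNext u t hj]
      simp only [sum_potentialNext]
      exact ih

/-- Before time `t` the potential is 0, and at time `t` it can only jump upwards. It is therefore a
nonnegative submartingale with mean bounded by `harmonic t`. -/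
theorem ae_exists_tendsto_potential (he : IsRRTProcess e P) :
    ∀ᵐ ω ∂P, ∀ u t, ∃ c, Tendsto (fun n => potential u t n (enc e ω)) atTop (𝓝 c) := by
  rw [ae_all_iff]
  intro u
  rw [ae_all_iff]
  intro t
  refine ae_exists_tendsto_of_submartingale (submartingale_of_step he (potential u t)
    (dependsBelow_potential u t) (potentialNext u t)
    (fun n j hj => dependsBelow_potentialNext u t hj) (fun n x => ?_)
    fun n x => (sum_potentialNext u t n x).ge) (K := harmonic t) fun n => ?_
  · by_cases ht : t ≤ n
    · exact (potential_succ ht x).ge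
    · rw [potentialNext, if_neg fun h => ht h.1]
      exact potential_nonneg _ _ _ _
  · simp only [abs_of_nonneg (potential_nonneg _ _ _ _)]
    exact integral_potential_le he u t n

/-- Second Borel–Cantelli lemma: the choices are independent and node `j` is chosen with probability
`1 / (k + 1)` at every step `k ≥ j`, a divergent series. -/
theorem ae_forall_frequently_parent (he : IsRRTProcess e P) :
    ∀ᵐ ω ∂P, ∀ j, ∃ᶠ n in atTop, (e n ω : ℕ) = j := by
  rw [ae_all_iff]
  intro j
  set s : ℕ → Set Ω := fun n => e n ⁻¹' {i | (i : ℕ) = j} with hs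
  have hsm : ∀ n, MeasurableSet (s n) := fun n => he.measurable n trivial
  have hindep : iIndepSet s P := by
    rw [iIndepSet_iff_meas_biInter hsm]
    intro t
    exact he.indep.meas_biInter fun i _ => ⟨_, trivial, rfl⟩
  have hP : ∀ n, P (s (n + j)) = 1 / ((n + j : ℕ) + 1 : ENNReal) := by
    intro n
    have h6 : {x : Fin (n + j + 1) | (x : ℕ) = j} = {⟨j, by omega⟩} := by
      ext x
      simp [Fin.ext_iff]
    rw [hs]
    simp only [h6, he.uniform]
  have hsum : ∑' n, P (s n) = ⊤ := by
    by_contra hne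
    have h1 : ∑' n, P (s (n + j)) ≠ ⊤ :=
      ne_top_of_le_ne_top hne (ENNReal.tsum_comp_le_tsum_of_injective (add_left_injective j) _)
    have h2 := ENNReal.summable_toReal h1
    refine Real.not_summable_one_div_natCast ((summable_nat_add_iff (j + 1)).1 (h2.congr ?_))
    intro n
    rw [hP, ENNReal.toReal_div, ENNReal.toReal_add (by simp) (by simp), ENNReal.toReal_natCast,
      ENNReal.toReal_one, ← add_assoc, Nat.cast_succ]
  have hlim := measure_limsup_eq_one hsm hindep hsum
  have hmeas : MeasurableSet (limsup s atTop) := MeasurableSet.measurableSet_limsup hsm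
  have hae := (prob_compl_eq_zero_iff hmeas).2 hlim
  rw [← mem_ae_iff] at hae
  filter_upwards [hae] with ω hω
  rw [mem_limsup_iff_frequently_mem] at hω
  exact hω

/-- The child with letter `a` is born when the degree of its parent first reaches `a`. -/
theorem exists_word_of_frequently (x : Encoding) (h : ∀ j, ∃ᶠ n in atTop, (x n : ℕ) = j)
    (u : Node) : ∃ j, word x j = u := by
  induction u using List.reverseRecOn with
  | nil => exact ⟨0, word_zero x⟩
  | append_singleton u a ih =>
    obtain ⟨j, hj⟩ := ih
    have hunb : ∀ d, ∃ n, d ≤ deg x n j := by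
      intro d
      induction d with
      | zero => exact ⟨0, Nat.zero_le _⟩
      | succ d ihd =>
        obtain ⟨n, hn⟩ := ihd
        obtain ⟨m, hm, hmj⟩ := frequently_atTop.1 (h j) n
        refine ⟨m + 1, ?_⟩
        rw [deg_succ, if_pos hmj]
        have : deg x n j ≤ deg x m j := deg_mono x j hm
        omega
    have hex := hunb a
    classical
    set n := Nat.find hex with hn
    have h1 : (a : ℕ) ≤ deg x n j := Nat.find_spec hex
    have ha := a.pos
    obtain ⟨m, hm⟩ : ∃ m, n = m + 1 := by
      refine Nat.exists_eq_succ_of_ne_zero fun h0 => ?_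
      rw [h0, deg_eq_zero x (Nat.zero_le _)] at h1
      omega
    have h2 : deg x m j < a := by
      by_contra hlt
      exact Nat.find_min hex (show m < Nat.find hex by omega) (not_lt.1 hlt)
    rw [hm, deg_succ] at h1
    split_ifs at h1 with hmj
    · refine ⟨m + 1, ?_⟩
      rw [word_succ, hmj, hj]
      congr 2
      refine PNat.eq ?_
      rw [Nat.succPNat_coe]
      omega
    · omega

theorem ae_exists_pos_le_cnt (he : IsRRTProcess e P) :
    ∀ᵐ ω ∂P, ∀ u, ∃ δ > 0, ∀ᶠ n : ℕ in atTop, δ ≤ (cnt (enc e ω) n u : ℝ) / (n + 1) := by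
  filter_upwards [ae_exists_tendsto_potential he, ae_forall_frequently_parent he] with ω h1 h2 u
  obtain ⟨t, ht⟩ := exists_word_of_frequently (enc e ω) h2 u
  obtain ⟨c, hc⟩ := h1 u t
  obtain ⟨K, hK⟩ := hc.bddAbove_range
  -- A potential bounded by `K` gives `log (n + 1) ≤ K + 1 + log cnt`, by the logarithmic bounds on
  -- harmonic numbers.
  refine ⟨Real.exp (-(K + 1)), Real.exp_pos _, ?_⟩
  filter_upwards [eventually_ge_atTop t] with n hn
  have hpos : 0 < cnt (enc e ω) t u := (cnt_pos_iff _ _ _).2 ⟨t, le_rfl, ht⟩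
  have hpos' : 0 < cnt (enc e ω) n u := hpos.trans_le (cnt_mono _ u hn)
  have h3 : potential u t n (enc e ω) ≤ K := hK ⟨n, rfl⟩
  rw [potential, if_pos ⟨hn, hpos⟩] at h3
  have h4 := log_add_one_le_harmonic n
  have h5 : (harmonic (cnt (enc e ω) n u - 1) : ℝ) ≤ harmonic (cnt (enc e ω) n u) :=
    harmonic_mono (Nat.sub_le _ _)
  have h6 := harmonic_le_one_add_log (cnt (enc e ω) n u)
  have hc' : (0 : ℝ) < cnt (enc e ω) n u := by exact_mod_cast hpos'
  rw [← Real.le_log_iff_exp_le (by positivity), Real.log_div hc'.ne' (by positivity)]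
  push_cast at h4
  linarith

end

/-! ### Limits along a typical encoding -/

/-- The encoding `x` has subtree proportions converging to the positive function `L`, with
geometrically decaying sizes of the subtrees of siblings. -/
structure IsGood (x : Encoding) (L : Node → ℝ) : Prop where
  lim : ∀ u, Tendsto (fun n : ℕ => (cnt x n u : ℝ) / (n + 1)) atTop (𝓝 (L u))
  pos : ∀ u, 0 < L u
  bdd : ∀ u, ∃ K : ℝ, ∀ n : ℕ, childSum u n x ≤ K * (n + 1)

/-- A word below `u` is either `u` itself or lies below exactly one child of `u`. -/
theorem prefix_indicator_eq (u w : Node) :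
    (if u <+: w then (1 : ℝ) else 0) =
      (if w = u then 1 else 0) + ∑' i : ℕ+, if u ++ [i] <+: w then (1 : ℝ) else 0 := by
  induction w using List.reverseRecOn with
  | nil =>
    by_cases h : u = []
    · subst h
      simp
    · simp [h, Ne.symm h]
  | append_singleton w a ih =>
    rw [tsum_child_snoc u w a fun _ => (1 : ℝ)]
    have h1 : (if w = u then (1 : ℝ) else 0) = if u = w then 1 else 0 := by
      simp only [eq_comm]
    have h2 : (if u <+: w ++ [a] then (1 : ℝ) else 0) =
        (if w ++ [a] = u then 1 else 0) + if u <+: w then 1 else 0 := by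
      by_cases h : u = w ++ [a]
      · subst h
        have h3 : ¬ w ++ [a] <+: w := fun h => by
          have := h.length_le
          simp at this
        simp [h3]
      · have h3 : u <+: w ++ [a] ↔ u <+: w := by
          rw [prefix_snoc_iff]
          tauto
        simp only [h3, if_neg (Ne.symm h), zero_add]
    rw [h2, ih, h1]
    ring

theorem tsum_cnt (x : Encoding) (n : ℕ) (u : Node) :
    ∑' i : ℕ+, (cnt x n (u ++ [i]) : ℝ) =
      cnt x n u - ∑ j ∈ Finset.range (n + 1), if word x j = u then (1 : ℝ) else 0 := by
  simp only [cnt_eq_sum]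
  rw [Summable.tsum_finsetSum fun j _ => summable_child u (word x j) fun _ => (1 : ℝ),
    ← Finset.sum_sub_distrib]
  refine Finset.sum_congr rfl fun j _ => ?_
  rw [prefix_indicator_eq]
  ring

theorem harmonic_sub_le_log {a b : ℕ} (ha : 0 < a) (hab : a ≤ b) :
    (harmonic b : ℝ) - harmonic a ≤ Real.log (b / a) := by
  have ha' : (0 : ℝ) < a := by exact_mod_cast ha
  induction b, hab using Nat.le_induction with
  | base => simp [div_self ha'.ne']
  | succ b hb ih =>
    have hb' : (0 : ℝ) < b := by exact_mod_cast ha.trans_le hb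
    have h1 := Real.one_sub_inv_le_log_of_pos (x := ((b : ℝ) + 1) / b) (by positivity)
    have h2 : 1 - (((b : ℝ) + 1) / b)⁻¹ = ((b : ℝ) + 1)⁻¹ := by
      field_simp
      ring
    rw [h2, Real.log_div (by positivity) hb'.ne'] at h1
    rw [Real.log_div hb'.ne' ha'.ne'] at ih
    rw [harmonic_succ, Real.log_div (by positivity) ha'.ne']
    push_cast at h1 ih ⊢
    linarith

/-- From `log y ≤ y - 1` at `y = 1 / √t`. Replacing entropy terms by square roots preserves
geometric decay in the child index. -/
theorem mul_one_sub_log_le_sqrt {t : ℝ} (ht : 0 < t) :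
    t * (1 - Real.log t) ≤ 2 * Real.sqrt t := by
  have hs : 0 < Real.sqrt t := Real.sqrt_pos.2 ht
  have h1 := Real.log_le_sub_one_of_pos (x := (Real.sqrt t)⁻¹) (by positivity)
  rw [Real.log_inv, Real.log_sqrt ht.le] at h1
  have h2 : t * (Real.sqrt t)⁻¹ = Real.sqrt t := by
    nth_rewrite 1 [← Real.mul_self_sqrt ht.le]
    field_simp
  nlinarith

namespace IsGood

variable {x : Encoding} {L : Node → ℝ}

theorem exists_geometric (h : IsGood x L) (u : Node) : ∃ K : ℝ, 0 ≤ K ∧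
    (∀ (n : ℕ) (i : ℕ+), (cnt x n (u ++ [i]) : ℝ) / (n + 1) ≤ K * (2 / 3) ^ (i : ℕ)) ∧
    ∀ n : ℕ, ∀ j ≤ n, word x j = u → (3 / 2 : ℝ) ^ deg x n j ≤ K * (n + 1) := by
  obtain ⟨K, hK⟩ := h.bdd u
  refine ⟨K, ?_, fun n i => ?_, fun n j hj hu => ?_⟩
  · have h1 := (childSum_nonneg u 0 x).trans (hK 0)
    simpa using h1
  · have h1 := (le_childSum x n u i).trans (hK n)
    rw [div_le_iff₀ (by positivity)]
    have h2 : (2 / 3 : ℝ) ^ (i : ℕ) * (3 / 2) ^ (i : ℕ) = 1 := by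
      rw [← mul_pow]
      norm_num
    have h3 : (0 : ℝ) < (2 / 3) ^ (i : ℕ) := by positivity
    have h4 := mul_le_mul_of_nonneg_left h1 h3.le
    calc (cnt x n (u ++ [i]) : ℝ)
        = (2 / 3) ^ (i : ℕ) * ((cnt x n (u ++ [i]) : ℝ) * (3 / 2) ^ (i : ℕ)) := by
          rw [mul_left_comm, h2, mul_one]
      _ ≤ _ := h4
      _ = _ := by ring
  · rw [← hu] at hK
    exact (pow_deg_le_childSum x hj).trans (hK n)

theorem summable_geometric_pnat {r : ℝ} (h0 : 0 ≤ r) (h1 : r < 1) :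
    Summable fun i : ℕ+ => r ^ (i : ℕ) :=
  (summable_geometric_of_lt_one h0 h1).comp_injective PNat.coe_injective

/-- At most one node carries the word `u`, so a contribution of order `o(n)` from it disappears
after normalization. -/
theorem tendsto_word_indicator (x : Encoding) (u : Node) {f : ℕ → ℕ → ℝ} {b : ℕ → ℝ}
    (hf : ∀ n, ∀ j ≤ n, word x j = u → |f n j| ≤ b n)
    (hb : Tendsto (fun n : ℕ => b n / ((n : ℝ) + 1)) atTop (𝓝 0)) (hb0 : ∀ n, 0 ≤ b n) :
    Tendsto (fun n : ℕ => (∑ j ∈ Finset.range (n + 1), if word x j = u then f n j else 0) /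
      ((n : ℝ) + 1)) atTop (𝓝 0) := by
  refine squeeze_zero_norm (fun n => ?_) hb
  rw [Real.norm_eq_abs, abs_div, abs_of_pos (by positivity : (0 : ℝ) < n + 1)]
  gcongr
  calc |∑ j ∈ Finset.range (n + 1), if word x j = u then f n j else 0|
      ≤ ∑ j ∈ Finset.range (n + 1), |if word x j = u then f n j else 0| :=
        Finset.abs_sum_le_sum_abs _ _
    _ ≤ ∑ j ∈ Finset.range (n + 1), (if word x j = u then (1 : ℝ) else 0) * b n := by
        refine Finset.sum_le_sum fun j hj => ?_
        split_ifs with h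
        · rw [one_mul]
          exact hf n j (by rw [Finset.mem_range] at hj; omega) h
        · simp
    _ = (∑ j ∈ Finset.range (n + 1), if word x j = u then (1 : ℝ) else 0) * b n := by
        rw [Finset.sum_mul]
    _ ≤ 1 * b n := mul_le_mul_of_nonneg_right (sum_word_eq_le_one x u _) (hb0 n)
    _ = b n := one_mul _

theorem tendsto_inv_add_one : Tendsto (fun n : ℕ => 1 / ((n : ℝ) + 1)) atTop (𝓝 0) :=
  tendsto_one_div_add_atTop_nhds_zero_nat

theorem le_geometric (h : IsGood x L) {u : Node} {K : ℝ}
    (hK : ∀ (n : ℕ) (i : ℕ+), (cnt x n (u ++ [i]) : ℝ) / (n + 1) ≤ K * (2 / 3) ^ (i : ℕ))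
    (i : ℕ+) : L (u ++ [i]) ≤ K * (2 / 3) ^ (i : ℕ) :=
  le_of_tendsto (h.lim _) (Eventually.of_forall fun n => hK n i)

/-- No mass is lost in the limit: the geometric bound allows dominated convergence over the
children, and node `u` itself weighs `1 / (n + 1)`. -/
theorem hasSum_children (h : IsGood x L) (u : Node) : HasSum (fun i => L (u ++ [i])) (L u) := by
  obtain ⟨K, hK0, hK, -⟩ := h.exists_geometric u
  have hs : Summable fun i : ℕ+ => K * (2 / 3 : ℝ) ^ (i : ℕ) :=
    (summable_geometric_pnat (by norm_num) (by norm_num)).mul_left K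
  have h1 := tendsto_tsum_of_dominated_convergence
    (f := fun (n : ℕ) (i : ℕ+) => (cnt x n (u ++ [i]) : ℝ) / ((n : ℝ) + 1)) hs
    (fun i => h.lim (u ++ [i])) (Eventually.of_forall fun n i => by
      rw [Real.norm_eq_abs, abs_of_nonneg (by positivity)]
      exact hK n i)
  have h2 : ∀ n : ℕ, ∑' i : ℕ+, (cnt x n (u ++ [i]) : ℝ) / ((n : ℝ) + 1) =
      (cnt x n u : ℝ) / (n + 1) -
        (∑ j ∈ Finset.range (n + 1), if word x j = u then (1 : ℝ) else 0) / (n + 1) := by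
    intro n
    rw [tsum_div_const, tsum_cnt, sub_div]
  simp only [h2] at h1
  have h3 := (h.lim u).sub (tendsto_word_indicator x u (f := fun _ _ => 1) (b := fun _ => 1)
    (fun _ _ _ _ => by simp) tendsto_inv_add_one fun _ => zero_le_one)
  rw [sub_zero] at h3
  have hsum : Summable fun i => L (u ++ [i]) :=
    hs.of_nonneg_of_le (fun i => (h.pos _).le) (h.le_geometric hK)
  rw [tendsto_nhds_unique h3 h1]
  exact hsum.hasSum

theorem summable_id_mul_geometric (K : ℝ) :
    Summable fun i : ℕ+ => K * (2 / 3 : ℝ) ^ (i : ℕ) * ((i : ℝ) + 2) := by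
  have h1 : Summable fun n : ℕ => (n : ℝ) ^ 1 * (2 / 3 : ℝ) ^ n :=
    summable_pow_mul_geometric_of_norm_lt_one 1 (by norm_num)
  have h2 : Summable fun n : ℕ => (2 / 3 : ℝ) ^ n :=
    summable_geometric_of_lt_one (by norm_num) (by norm_num)
  have h3 := ((h1.add (h2.mul_left 2)).mul_left K).comp_injective PNat.coe_injective
  refine h3.congr fun i => ?_
  simp only [Function.comp_apply]
  ring

theorem summable_id_mul (h : IsGood x L) (u : Node) :
    Summable fun i : ℕ+ => (i : ℝ) * L (u ++ [i]) := by
  obtain ⟨K, hK0, hK, -⟩ := h.exists_geometric u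
  refine (summable_id_mul_geometric K).of_nonneg_of_le
    (fun i => mul_nonneg (by positivity) (h.pos _).le) fun i => ?_
  rw [mul_comm]
  exact mul_le_mul (h.le_geometric hK i) (by linarith) (by positivity) (by positivity)

theorem tendsto_widthToll (h : IsGood x L) (u : Node) :
    Tendsto (fun n : ℕ => widthToll n u x / ((n : ℝ) + 1)) atTop
      (𝓝 (∑' i : ℕ+, L (u ++ [i]) * ((i : ℝ) - 2))) := by
  obtain ⟨K, hK0, hK, hdeg⟩ := h.exists_geometric u
  have h1 := tendsto_tsum_of_dominated_convergence
    (f := fun (n : ℕ) (i : ℕ+) => (cnt x n (u ++ [i]) : ℝ) / ((n : ℝ) + 1) * ((i : ℝ) - 2))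
    (summable_id_mul_geometric K) (fun i => (h.lim (u ++ [i])).mul_const ((i : ℝ) - 2))
    (Eventually.of_forall fun n i => by
      have hi : (0 : ℝ) ≤ (i : ℝ) := by positivity
      rw [norm_mul, Real.norm_eq_abs, Real.norm_eq_abs, abs_of_nonneg (by positivity)]
      exact mul_le_mul (hK n i) (abs_le.2 ⟨by linarith, by linarith⟩) (abs_nonneg _)
        (by positivity))
  have h2 : Tendsto (fun n : ℕ => (∑ j ∈ Finset.range (n + 1),
      if word x j = u then (deg x n j : ℝ) else 0) / ((n : ℝ) + 1)) atTop (𝓝 0) := by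
    -- Since `(6 / 5) ^ 2 < 3 / 2`, Bernoulli's inequality gives `1 + d / 5 ≤ (6 / 5) ^ d ≤ √(K (n +
    -- 1))`. This crude bound on the degree already suffices.
    refine tendsto_word_indicator x u (f := fun n j => (deg x n j : ℝ))
      (b := fun n => 5 * Real.sqrt (K * (n + 1))) (fun n j hj hu => ?_) ?_ fun n => by positivity
    · set d := deg x n j with hd
      have h3 := one_add_mul_le_pow (a := (1 / 5 : ℝ)) (by norm_num) d
      have h4 : ((1 : ℝ) + 1 / 5) ^ d ≤ Real.sqrt (K * (n + 1)) := by
        refine Real.le_sqrt_of_sq_le ?_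
        rw [← pow_mul, mul_comm d 2, pow_mul]
        calc (((1 : ℝ) + 1 / 5) ^ 2) ^ d ≤ (3 / 2) ^ d := by
              gcongr
              norm_num
          _ ≤ _ := hdeg n j hj hu
      rw [abs_of_nonneg (by positivity)]
      linarith
    · have h3 : ∀ n : ℕ, 5 * Real.sqrt (K * ((n : ℝ) + 1)) / ((n : ℝ) + 1) =
          5 * Real.sqrt (K * (1 / ((n : ℝ) + 1))) := by
        intro n
        have hn : (0 : ℝ) < n + 1 := by positivity
        rw [Real.sqrt_mul hK0, Real.sqrt_mul hK0, Real.sqrt_div zero_le_one, Real.sqrt_one]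
        have := Real.mul_self_sqrt hn.le
        field_simp
        rw [Real.sq_sqrt hn.le]
      simp only [h3]
      have h4 := ((Real.continuous_sqrt.tendsto _).comp (tendsto_inv_add_one.const_mul K)).const_mul
        (5 : ℝ)
      simpa using h4
  have h5 := h1.add h2
  rw [add_zero] at h5
  refine h5.congr fun n => ?_
  rw [widthToll, add_div, ← tsum_div_const]
  congr 1
  exact tsum_congr fun i => by ring

theorem tendsto_cnt_atTop (h : IsGood x L) (u : Node) : Tendsto (fun n => cnt x n u) atTop atTop := by
  rw [← tendsto_natCast_atTop_iff (R := ℝ)]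
  have h1 : Tendsto (fun n : ℕ => (n : ℝ) + 1) atTop atTop :=
    tendsto_atTop_add_const_right _ _ tendsto_natCast_atTop_atTop
  refine ((h.lim u).pos_mul_atTop (h.pos u) h1).congr fun n => ?_
  field_simp

/-- Euler's constant cancels between the two harmonic numbers, leaving the logarithm of the ratio of
subtree sizes. -/
theorem tendsto_child_path (h : IsGood x L) (u : Node) (i : ℕ+) :
    Tendsto (fun n : ℕ => (cnt x n (u ++ [i]) : ℝ) / (n + 1) *
      (1 + (harmonic (cnt x n (u ++ [i])) : ℝ) - harmonic (cnt x n u))) atTop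
      (𝓝 (L (u ++ [i]) * (1 + Real.log (L (u ++ [i]) / L u)))) := by
  refine (h.lim _).mul ?_
  have h1 := Real.tendsto_harmonic_sub_log.comp (h.tendsto_cnt_atTop (u ++ [i]))
  have h2 := Real.tendsto_harmonic_sub_log.comp (h.tendsto_cnt_atTop u)
  have h3 := ((h.lim (u ++ [i])).div (h.lim u) (h.pos u).ne').log
    (div_pos (h.pos _) (h.pos u)).ne'
  have h4 := (((h1.sub h2).add h3).const_add 1)
  rw [sub_self, zero_add] at h4
  refine h4.congr' ?_
  filter_upwards [(h.tendsto_cnt_atTop (u ++ [i])).eventually_gt_atTop 0,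
    (h.tendsto_cnt_atTop u).eventually_gt_atTop 0] with n hn1 hn2
  have hn1' : (0 : ℝ) < cnt x n (u ++ [i]) := by exact_mod_cast hn1
  have hn2' : (0 : ℝ) < cnt x n u := by exact_mod_cast hn2
  have hn : (0 : ℝ) < n + 1 := by positivity
  simp only [Function.comp_apply, Pi.div_apply]
  rw [div_div_div_cancel_right₀ hn.ne', Real.log_div hn1'.ne' hn2'.ne']
  ring

theorem abs_child_path_le {u : Node} {K : ℝ} (hK0 : 0 ≤ K)
    (hK : ∀ (n : ℕ) (i : ℕ+), (cnt x n (u ++ [i]) : ℝ) / (n + 1) ≤ K * (2 / 3) ^ (i : ℕ))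
    (n : ℕ) (i : ℕ+) :
    |(cnt x n (u ++ [i]) : ℝ) / (n + 1) *
      (1 + (harmonic (cnt x n (u ++ [i])) : ℝ) - harmonic (cnt x n u))| ≤
      2 * Real.sqrt K * Real.sqrt (2 / 3) ^ (i : ℕ) := by
  rcases Nat.eq_zero_or_pos (cnt x n (u ++ [i])) with h0 | h0
  · rw [h0]
    simp only [Nat.cast_zero, zero_div, zero_mul, abs_zero]
    positivity
  · have hle : cnt x n (u ++ [i]) ≤ cnt x n u := cnt_anti x n (List.prefix_append _ _)
    have hc : (0 : ℝ) < cnt x n (u ++ [i]) := by exact_mod_cast h0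
    have hn : (0 : ℝ) < n + 1 := by positivity
    set t := (cnt x n (u ++ [i]) : ℝ) / (n + 1) with ht
    have ht0 : 0 < t := by positivity
    have h1 := harmonic_sub_le_log h0 hle
    have h2 := harmonic_mono hle
    have h3 : Real.log ((cnt x n u : ℝ) / cnt x n (u ++ [i])) ≤ -Real.log t := by
      rw [← Real.log_inv, ht, inv_div]
      have h4 : (cnt x n u : ℝ) ≤ ((n + 1 : ℕ) : ℝ) := Nat.cast_le.2 (cnt_le x n u)
      push_cast at h4
      have h5 : (0 : ℝ) < cnt x n u := by exact_mod_cast h0.trans_le hle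
      gcongr
    have h4 : |1 + (harmonic (cnt x n (u ++ [i])) : ℝ) - harmonic (cnt x n u)| ≤
        1 - Real.log t := by
      rw [abs_le]
      constructor <;> linarith
    rw [abs_mul, abs_of_pos ht0]
    calc _ ≤ t * (1 - Real.log t) := by gcongr
      _ ≤ 2 * Real.sqrt t := mul_one_sub_log_le_sqrt ht0
      _ ≤ 2 * Real.sqrt (K * (2 / 3) ^ (i : ℕ)) := by
          gcongr
          exact hK n i
      _ = _ := by
          have h5 : Real.sqrt ((2 / 3) ^ (i : ℕ)) = Real.sqrt (2 / 3) ^ (i : ℕ) := by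
            rw [Real.sqrt_eq_iff_mul_self_eq (by positivity) (by positivity), ← mul_pow,
              Real.mul_self_sqrt (by norm_num)]
          rw [Real.sqrt_mul hK0, h5]
          ring

theorem summable_sqrt_geometric (K : ℝ) :
    Summable fun i : ℕ+ => 2 * Real.sqrt K * Real.sqrt (2 / 3) ^ (i : ℕ) := by
  refine (summable_geometric_pnat (Real.sqrt_nonneg _) ?_).mul_left _
  rw [Real.sqrt_lt' one_pos]
  norm_num

theorem summable_log (h : IsGood x L) (u : Node) :
    Summable fun i : ℕ+ => L (u ++ [i]) * Real.log (L (u ++ [i]) / L u) := by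
  obtain ⟨K, hK0, hK, -⟩ := h.exists_geometric u
  have h1 : Summable fun i : ℕ+ => L (u ++ [i]) * (1 + Real.log (L (u ++ [i]) / L u)) :=
    (summable_sqrt_geometric K).of_norm_bounded fun i =>
      le_of_tendsto (h.tendsto_child_path u i).norm
        (Eventually.of_forall fun n => abs_child_path_le hK0 hK n i)
  refine (h1.sub (h.hasSum_children u).summable).congr fun i => ?_
  ring

theorem tendsto_pathToll (h : IsGood x L) (u : Node) :
    Tendsto (fun n : ℕ => pathToll n u x / ((n : ℝ) + 1)) atTop
      (𝓝 (L u + ∑' i : ℕ+, L (u ++ [i]) * Real.log (L (u ++ [i]) / L u))) := by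
  obtain ⟨K, hK0, hK, -⟩ := h.exists_geometric u
  have h1 := tendsto_tsum_of_dominated_convergence
    (f := fun (n : ℕ) (i : ℕ+) => (cnt x n (u ++ [i]) : ℝ) / ((n : ℝ) + 1) *
      (1 + (harmonic (cnt x n (u ++ [i])) : ℝ) - harmonic (cnt x n u)))
    (summable_sqrt_geometric K) (h.tendsto_child_path u)
    (Eventually.of_forall fun n i => abs_child_path_le hK0 hK n i)
  have h2 : Tendsto (fun n : ℕ => (∑ j ∈ Finset.range (n + 1),
      if word x j = u then 1 - (harmonic (cnt x n u) : ℝ) else 0) / ((n : ℝ) + 1))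
      atTop (𝓝 0) := by
    refine tendsto_word_indicator x u (f := fun n _ => 1 - (harmonic (cnt x n u) : ℝ))
      (b := fun n => 2 + Real.log ((n : ℝ) + 1)) (fun n j hj hu => ?_) ?_ fun n => ?_
    · have h3 := harmonic_mono (cnt_le x n u)
      have h4 := harmonic_nonneg (cnt x n u)
      have h5 := harmonic_le_one_add_log (n + 1)
      push_cast at h5
      have h6 : 0 ≤ Real.log ((n : ℝ) + 1) := Real.log_nonneg (by
        linarith [(Nat.cast_nonneg n : (0 : ℝ) ≤ n)])
      rw [abs_le]
      constructor <;> linarith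
    · have h3 : Tendsto (fun n : ℕ => (n : ℝ) + 1) atTop atTop :=
        tendsto_atTop_add_const_right _ _ tendsto_natCast_atTop_atTop
      have h4 := (Real.isLittleO_log_id_atTop.tendsto_div_nhds_zero).comp h3
      have h5 := (tendsto_inv_add_one.const_mul 2).add h4
      rw [mul_zero, add_zero] at h5
      refine h5.congr fun n => ?_
      simp only [Function.comp_apply, id_eq]
      ring
    · have : 0 ≤ Real.log ((n : ℝ) + 1) := Real.log_nonneg (by
        linarith [(Nat.cast_nonneg n : (0 : ℝ) ≤ n)])
      positivity
  have h5 := h1.add h2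
  have h6 : ∑' i : ℕ+, L (u ++ [i]) * (1 + Real.log (L (u ++ [i]) / L u)) =
      L u + ∑' i : ℕ+, L (u ++ [i]) * Real.log (L (u ++ [i]) / L u) := by
    have h7 := (h.hasSum_children u).summable.tsum_add (h.summable_log u)
    rw [(h.hasSum_children u).tsum_eq] at h7
    rw [← h7]
    exact tsum_congr fun i => by ring
  rw [add_zero, h6] at h5
  refine h5.congr fun n => ?_
  rw [pathToll, add_div, ← tsum_div_const]
  congr 1
  exact tsum_congr fun i => by ring

end IsGood

/-! ### Existence of the limit tree -/

/-- A prefix-closed chain of words is the set of prefixes of a point of the completion. -/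
theorem exists_nodeBar_of_chain (T : Set Node) (hnil : [] ∈ T)
    (hclosed : ∀ u v, v ∈ T → u <+: v → u ∈ T)
    (hchain : ∀ u v, u ∈ T → v ∈ T → u <+: v ∨ v <+: u) :
    ∃ b : NodeBar, ∀ u, IsPrefixBar u b ↔ u ∈ T := by
  by_cases hall : ∀ n, ∃ u ∈ T, u.length = n
  · choose w hwT hwl using hall
    have hpre : ∀ {u v}, u ∈ T → v ∈ T → u.length ≤ v.length → u <+: v := by
      intro u v hu hv hl
      rcases hchain u v hu hv with h | h
      · exact h
      · rw [h.eq_of_length_le hl]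
    refine ⟨NodeBar.infinite fun i => (w (i + 1))[i]'(by rw [hwl]; omega), fun u => ?_⟩
    have key : ∀ v ∈ T, ∀ (i : ℕ) (h : i < v.length),
        v[i] = (w (i + 1))[i]'(by rw [hwl]; omega) := by
      intro v hv i hi
      exact ((hpre (hwT (i + 1)) hv (by rw [hwl]; omega)).getElem _).symm
    constructor
    · intro h
      have h1 : u = w u.length := by
        refine List.ext_getElem (hwl _).symm fun i hi hi' => ?_
        rw [h i hi, key _ (hwT _) i hi']
      rw [h1]
      exact hwT _
    · intro hu i hi
      exact key u hu i hi
  · push Not at hall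
    obtain ⟨n, hn⟩ := hall
    have hlt : ∀ u ∈ T, u.length < n := by
      intro u hu
      by_contra hle
      refine hn (u.take n) (hclosed _ u hu (List.take_prefix n u)) ?_
      rw [List.length_take]
      omega
    have hfin : (List.length '' T).Finite :=
      (Set.finite_lt_nat n).subset (by rintro _ ⟨u, hu, rfl⟩; exact hlt u hu)
    obtain ⟨_, ⟨u, hu, rfl⟩, hmax⟩ := Set.exists_max_image _ id hfin ⟨_, _, hnil, rfl⟩
    -- The longest word of the chain. The escaping point over the same word lies in the same
    -- cylinders and would serve equally well.
    refine ⟨NodeBar.finite u, fun v => ⟨fun h => hclosed _ _ hu h, fun hv => ?_⟩⟩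
    rcases hchain v u hv hu with h | h
    · exact h
    · have h1 : v.length ≤ u.length := hmax _ ⟨v, hv, rfl⟩
      change v <+: u
      rw [h.eq_of_length_le h1]

/-! ### Realizing the limiting masses by nested intervals. -/

/-- The total of `L` over the first `m` children of `u`. -/
noncomputable def childTotal (L : Node → ℝ) (u : Node) (m : ℕ) : ℝ :=
  ∑ j ∈ Finset.range m, L (u ++ [Nat.succPNat j])

/-- The left end point of the interval that represents `pre ++ u` inside the interval of `pre`. -/
noncomputable def leftEnd (L : Node → ℝ) : Node → Node → ℝ
  | _, [] => 0
  | pre, i :: t => childTotal L pre (i.natPred) + leftEnd L (pre ++ [i]) t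

theorem leftEnd_snoc (L : Node → ℝ) (pre u : Node) (i : ℕ+) :
    leftEnd L pre (u ++ [i]) = leftEnd L pre u + childTotal L (pre ++ u) i.natPred := by
  induction u generalizing pre with
  | nil => simp [leftEnd]
  | cons a t ih =>
    rw [List.cons_append, leftEnd, leftEnd, ih]
    simp only [List.append_assoc, List.singleton_append]
    ring

/-- The interval that represents `u`. -/
noncomputable def nodeInterval (L : Node → ℝ) (u : Node) : Set ℝ :=
  Set.Ico (leftEnd L [] u) (leftEnd L [] u + L u)

/-- The masses of a subprobability flow down the tree of words. -/
structure IsFlow (L : Node → ℝ) : Prop where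
  nonneg : ∀ u, 0 ≤ L u
  nil : L [] = 1
  childTotal_le : ∀ u m, childTotal L u m ≤ L u

namespace IsFlow

variable {L : Node → ℝ}

theorem childTotal_mono (h : IsFlow L) (u : Node) : Monotone (childTotal L u) := by
  refine monotone_nat_of_le_succ fun m => ?_
  rw [childTotal, childTotal, Finset.sum_range_succ]
  exact le_add_of_nonneg_right (h.nonneg _)

theorem childTotal_succ (u : Node) (i : ℕ+) :
    childTotal L u i = childTotal L u i.natPred + L (u ++ [i]) := by
  have h1 : (i : ℕ) = i.natPred + 1 := (PNat.natPred_add_one i).symm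
  rw [h1, childTotal, Finset.sum_range_succ, PNat.succPNat_natPred, childTotal]

theorem nodeInterval_snoc_subset (h : IsFlow L) (u : Node) (i : ℕ+) :
    nodeInterval L (u ++ [i]) ⊆ nodeInterval L u := by
  unfold nodeInterval
  rw [leftEnd_snoc, List.nil_append]
  have h1 : 0 ≤ childTotal L u i.natPred := by
    have := h.childTotal_mono u (Nat.zero_le i.natPred)
    simpa [childTotal] using this
  have h2 := h.childTotal_le u i
  rw [childTotal_succ] at h2
  exact Set.Ico_subset_Ico (by linarith) (by linarith)

theorem nodeInterval_antitone (h : IsFlow L) {u v : Node} (huv : u <+: v) :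
    nodeInterval L v ⊆ nodeInterval L u := by
  obtain ⟨t, rfl⟩ := huv
  induction t using List.reverseRecOn with
  | nil => rw [List.append_nil]
  | append_singleton t a ih =>
    rw [← List.append_assoc]
    exact (h.nodeInterval_snoc_subset _ a).trans ih

theorem not_mem_of_lt (h : IsFlow L) (u : Node) {i j : ℕ+} (hij : i < j) {y : ℝ}
    (hi : y ∈ nodeInterval L (u ++ [i])) (hj : y ∈ nodeInterval L (u ++ [j])) : False := by
  unfold nodeInterval at hi hj
  rw [leftEnd_snoc, List.nil_append] at hi hj
  have h1 : (i : ℕ) ≤ j.natPred := by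
    have h2 := PNat.natPred_add_one j
    have h3 : (i : ℕ) < j := hij
    omega
  have h2 := h.childTotal_mono u h1
  rw [childTotal_succ] at h2
  linarith [hi.2, hj.1]

theorem chain (h : IsFlow L) {y : ℝ} (u v : Node) (hu : y ∈ nodeInterval L u)
    (hv : y ∈ nodeInterval L v) : u <+: v ∨ v <+: u := by
  induction u using List.reverseRecOn with
  | nil => exact Or.inl List.nil_prefix
  | append_singleton u i ih =>
    rcases ih (h.nodeInterval_snoc_subset u i hu) with ⟨t, rfl⟩ | h1
    · cases t with
      | nil => exact Or.inr (by rw [List.append_nil]; exact List.prefix_append _ _)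
      | cons j t =>
        have hv' : y ∈ nodeInterval L (u ++ [j]) :=
          h.nodeInterval_antitone ⟨t, by simp⟩ hv
        rcases lt_trichotomy i j with hij | rfl | hij
        · exact (h.not_mem_of_lt u hij hu hv').elim
        · exact Or.inl ⟨t, by simp⟩
        · exact (h.not_mem_of_lt u hij hv' hu).elim
    · exact Or.inr (h1.trans (List.prefix_append _ _))

/-- The words whose intervals contain a given `y` form a prefix-closed chain, hence come from a
point of `NodeBar`. Sending `y` to that point pushes Lebesgue measure on `[0, 1)` to a measure in
which each cylinder has the length of its interval. -/
theorem exists_mass_eq (h : IsFlow L) :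
    ∃ μ : ProbabilityMeasure NodeBar, ∀ u, mass μ u = L u := by
  have hex : ∀ y : ℝ, ∃ b : NodeBar, ∀ u, IsPrefixBar u b ↔ u = [] ∨ y ∈ nodeInterval L u := by
    intro y
    -- Adjoining the empty word makes the map total on `ℝ`; points outside `[0, 1)` carry no mass.
    refine exists_nodeBar_of_chain {u | u = [] ∨ y ∈ nodeInterval L u} (Or.inl rfl) ?_ ?_
    · rintro u v (rfl | hv) huv
      · exact Or.inl (List.prefix_nil.1 huv)
      · exact Or.inr (h.nodeInterval_antitone huv hv)
    · rintro u v (rfl | hu) (rfl | hv)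
      · exact Or.inl List.prefix_rfl
      · exact Or.inl List.nil_prefix
      · exact Or.inr List.nil_prefix
      · exact h.chain u v hu hv
  choose f hf using hex
  have hpre : ∀ u, f ⁻¹' cyl u = {y | u = [] ∨ y ∈ nodeInterval L u} := fun u => by
    ext y
    exact hf y u
  have hmeas : Measurable f := by
    refine measurable_generateFrom ?_
    rintro _ ⟨u, rfl⟩
    rw [hpre]
    exact (MeasurableSet.const _).union measurableSet_Ico
  have hcyl : ∀ u, MeasurableSet (cyl u) := fun u =>
    MeasurableSpace.measurableSet_generateFrom ⟨u, rfl⟩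
  have hunit : nodeInterval L [] = Set.Ico 0 1 := by
    rw [nodeInterval, h.nil, leftEnd, zero_add]
  have hprob : IsProbabilityMeasure ((volume.restrict (Set.Ico (0 : ℝ) 1)).map f) := by
    have : IsProbabilityMeasure (volume.restrict (Set.Ico (0 : ℝ) 1)) := ⟨by simp⟩
    exact Measure.isProbabilityMeasure_map hmeas.aemeasurable
  refine ⟨⟨_, hprob⟩, fun u => ?_⟩
  have h1 : f ⁻¹' cyl u ∩ Set.Ico 0 1 = nodeInterval L u := by
    rw [hpre, ← hunit]
    ext y
    constructor
    · rintro ⟨rfl | hy, hy'⟩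
      · exact hy'
      · exact hy
    · exact fun hy => ⟨Or.inr hy, h.nodeInterval_antitone List.nil_prefix hy⟩
  change ((volume.restrict (Set.Ico (0 : ℝ) 1)).map f).real (cyl u) = L u
  rw [measureReal_def, Measure.map_apply hmeas (hcyl u), Measure.restrict_apply (hmeas (hcyl u)), h1,
    nodeInterval, Real.volume_Ico, add_sub_cancel_left, ENNReal.toReal_ofReal (h.nonneg u)]

end IsFlow

/-- The flow that puts all its mass on the empty word. -/
theorem isFlow_root : IsFlow fun u : Node => if u = [] then (1 : ℝ) else 0 where
  nonneg u := by split_ifs <;> norm_num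
  nil := if_pos rfl
  childTotal_le u m := by
    unfold childTotal
    rw [Finset.sum_eq_zero fun j _ => if_neg (by simp)]
    split_ifs <;> norm_num

theorem sum_cnt_child_le (x : Encoding) (n : ℕ) (u : Node) (m : ℕ) :
    ∑ j ∈ Finset.range m, (cnt x n (u ++ [Nat.succPNat j]) : ℝ) ≤ cnt x n u := by
  simp only [cnt_eq_sum]
  rw [Finset.sum_comm]
  refine Finset.sum_le_sum fun l _ => ?_
  rw [← Finset.sum_filter, Finset.sum_const, nsmul_eq_mul, mul_one]
  have hc : ((Finset.range m).filter fun j => u ++ [Nat.succPNat j] <+: word x l).card ≤ 1 :=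
    Finset.card_le_one.2 fun a ha b hb => by
      rw [Finset.mem_filter] at ha hb
      exact Nat.succPNat_injective (subsingleton_child u (word x l) ha.2 hb.2)
  split_ifs with h
  · exact_mod_cast hc
  · rw [Finset.filter_false_of_mem fun j _ hj => h ((List.prefix_append _ _).trans hj)]
    simp

theorem isFlow_of_tendsto {x : Encoding} {L : Node → ℝ}
    (h : ∀ u, Tendsto (fun n : ℕ => (cnt x n u : ℝ) / (n + 1)) atTop (𝓝 (L u))) : IsFlow L where
  nonneg u := ge_of_tendsto' (h u) fun n => by positivity
  nil := by
    refine tendsto_nhds_unique (h []) (tendsto_const_nhds.congr fun n => ?_)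
    rw [cnt_nil]
    push_cast
    rw [div_self (by positivity)]
  childTotal_le u m := by
    refine le_of_tendsto_of_tendsto'
      (tendsto_finsetSum (Finset.range m) fun j _ => h (u ++ [Nat.succPNat j])) (h u) fun n => ?_
    rw [← Finset.sum_div]
    gcongr
    exact sum_cnt_child_le x n u m

theorem tendsto_harrisChain_iff {Ω : Type*} (e : (k : ℕ) → Ω → Fin (k + 1)) (ω : Ω) (u : Node)
    (c : ℝ) :
    Tendsto (fun n : ℕ => (subtreeSize (harrisChain e n ω) u : ℝ) / (n : ℝ)) atTop (𝓝 c) ↔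
      Tendsto (fun n : ℕ => (cnt (enc e ω) n u : ℝ) / (n + 1)) atTop (𝓝 c) := by
  rw [← tendsto_add_atTop_iff_nat 1]
  refine tendsto_congr fun n => ?_
  change (subtreeSize (harrisTree (enc e ω) (n + 1)) u : ℝ) / ((n + 1 : ℕ) : ℝ) = _
  rw [subtreeSize_harrisTree]
  push_cast
  rfl

theorem exists_isDoobMartinLimit {Ω : Type*} [MeasurableSpace Ω] {P : Measure Ω}
    [IsProbabilityMeasure P] {e : (k : ℕ) → Ω → Fin (k + 1)} (he : IsRRTProcess e P) :
    ∃ Xinf : Ω → ProbabilityMeasure NodeBar, IsDoobMartinLimit (harrisChain e) Xinf P := by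
  classical
  set G : Set Ω := {ω | ∀ u, ∃ c,
    Tendsto (fun n : ℕ => (cnt (enc e ω) n u : ℝ) / (n + 1)) atTop (𝓝 c)} with hG
  have hm : ∀ u (n : ℕ), Measurable fun ω => (cnt (enc e ω) n u : ℝ) / (n + 1) := fun u n =>
    ((dependsBelow_cnt n u).comp fun k => (k : ℝ) / ((n : ℝ) + 1)).measurable' he.measurable
  have hGm : MeasurableSet G := by
    have h1 : G = ⋂ u, {ω | ∃ c,
        Tendsto (fun n : ℕ => (cnt (enc e ω) n u : ℝ) / (n + 1)) atTop (𝓝 c)} := by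
      ext ω
      simp [hG]
    rw [h1]
    exact MeasurableSet.iInter fun u => measurableSet_exists_tendsto (hm u)
  -- The limsup is a measurable version of the limit, and off the convergence set the mass sits at
  -- the root. Thus `L ω` is a flow for every `ω`.
  set L : Ω → Node → ℝ := fun ω u =>
    if ω ∈ G then limsup (fun n : ℕ => (cnt (enc e ω) n u : ℝ) / (n + 1)) atTop
    else if u = [] then 1 else 0 with hL
  have hlim : ∀ ω ∈ G, ∀ u,
      Tendsto (fun n : ℕ => (cnt (enc e ω) n u : ℝ) / (n + 1)) atTop (𝓝 (L ω u)) := by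
    intro ω hω u
    obtain ⟨c, hc⟩ := hω u
    simp only [hL, if_pos hω]
    rwa [hc.limsup_eq]
  have hflow : ∀ ω, IsFlow (L ω) := by
    intro ω
    by_cases hω : ω ∈ G
    · exact isFlow_of_tendsto (hlim ω hω)
    · simp only [hL, if_neg hω]
      exact isFlow_root
  choose Xinf hX using fun ω => (hflow ω).exists_mass_eq
  refine ⟨Xinf, fun u => ?_, ?_⟩
  · simp only [hX, hL]
    exact Measurable.ite hGm (Measurable.limsup (hm u)) measurable_const
  · filter_upwards [ae_exists_tendsto_cnt he] with ω hω u
    rw [tendsto_harrisChain_iff, hX]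
    exact hlim ω hω u

/-! ### Convergence in `L^p` -/

section

variable {Ω : Type*} [MeasurableSpace Ω] {P : Measure Ω}

theorem TendstoInLp.mono_exponent [IsProbabilityMeasure P] {f : ℕ → Ω → ℝ} {g : Ω → ℝ} {p q : ℝ}
    (hpq : p ≤ q) (h : TendstoInLp f g q P) : TendstoInLp f g p P where
  memLp n := (h.memLp n).mono_exponent (ENNReal.ofReal_le_ofReal hpq)
  memLp_limit := h.memLp_limit.mono_exponent (ENNReal.ofReal_le_ofReal hpq)
  tendsto := tendsto_of_tendsto_of_tendsto_of_le_of_le tendsto_const_nhds h.tendsto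
    (fun _ => zero_le) fun n =>
      eLpNorm_le_eLpNorm_of_exponent_le (ENNReal.ofReal_le_ofReal hpq)
        ((h.memLp n).sub h.memLp_limit).aestronglyMeasurable

theorem TendstoInLp.add {f f' : ℕ → Ω → ℝ} {g g' : Ω → ℝ} {p : ℝ} (hp : 1 ≤ p)
    (h : TendstoInLp f g p P) (h' : TendstoInLp f' g' p P) :
    TendstoInLp (fun n => f n + f' n) (g + g') p P where
  memLp n := (h.memLp n).add (h'.memLp n)
  memLp_limit := h.memLp_limit.add h'.memLp_limit
  tendsto := by
    have h1 := h.tendsto.add h'.tendsto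
    rw [add_zero] at h1
    refine tendsto_of_tendsto_of_tendsto_of_le_of_le tendsto_const_nhds h1
      (fun _ => zero_le) fun n => ?_
    have h2 : f n + f' n - (g + g') = (f n - g) + (f' n - g') := by ring
    simp only [h2]
    exact eLpNorm_add_le ((h.memLp n).sub h.memLp_limit).aestronglyMeasurable
      ((h'.memLp n).sub h'.memLp_limit).aestronglyMeasurable (ENNReal.one_le_ofReal.2 hp)

theorem tendstoInLp_const [IsProbabilityMeasure P] {c : ℕ → ℝ} {d : ℝ} (hc : Tendsto c atTop (𝓝 d))
    {p : ℝ} (hp : 0 < p) : TendstoInLp (fun n (_ : Ω) => c n) (fun _ => d) p P where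
  memLp n := memLp_const _
  memLp_limit := memLp_const _
  tendsto := by
    have h1 : ∀ n, eLpNorm ((fun _ : Ω => c n) - fun _ => d) (ENNReal.ofReal p) P =
        ‖c n - d‖ₑ := by
      intro n
      have h2 : ((fun _ : Ω => c n) - fun _ => d) = fun _ => c n - d := rfl
      rw [h2, eLpNorm_const _ (by simpa using hp) (NeZero.ne P)]
      simp
    simp only [h1]
    have h3 := (hc.sub_const d).enorm
    simpa using h3

/-- Fatou's lemma for `L^p` norms. -/
theorem eLpNorm_le_of_ae_tendsto {f : ℕ → Ω → ℝ} {g : Ω → ℝ} {p b : ENNReal}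
    (hf : ∀ n, AEStronglyMeasurable (f n) P) (hb : ∀ᶠ n in atTop, eLpNorm (f n) p P ≤ b)
    (hlim : ∀ᵐ ω ∂P, Tendsto (fun n => f n ω) atTop (𝓝 (g ω))) : eLpNorm g p P ≤ b :=
  (Lp.eLpNorm_lim_le_liminf_eLpNorm hf g hlim).trans
    (liminf_le_of_frequently_le' hb.frequently)

variable [IsProbabilityMeasure P] {e : (k : ℕ) → Ω → Fin (k + 1)}

/-- Monotonicity of norms on a probability space passes from the even moment of order `2 * (k + 2) ≥
p` to `p`. The bound `ε` does not depend on the functional. -/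
theorem exists_eLpNorm_bound (he : IsRRTProcess e P) (p : ℝ) :
    ∃ ε : ℕ → ENNReal, Tendsto ε atTop (𝓝 0) ∧ (∀ m, ε m ≠ ⊤) ∧
      ∀ {Q : ℕ → Encoding → ℝ} {q : ℕ → ℕ → Encoding → ℝ}, IsUrn Q q → ∀ {m n : ℕ}, m ≤ n →
        eLpNorm (fun ω => IsUrn.ratio Q n (enc e ω) - IsUrn.ratio Q m (enc e ω))
          (ENNReal.ofReal p) P ≤ ε m := by
  obtain ⟨k, hk⟩ := exists_nat_ge p
  obtain ⟨η, hη, hbound⟩ := IsUrn.exists_moment_bound k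
  set N : ℕ := 2 * (k + 2) with hN
  have hN0 : (0 : ℝ) < N := by
    rw [hN]
    positivity
  refine ⟨fun m => ENNReal.ofReal (η m ^ (N : ℝ)⁻¹), ?_, fun m => ENNReal.ofReal_ne_top, ?_⟩
  · have h1 := ENNReal.tendsto_ofReal (hη.rpow_const (p := (N : ℝ)⁻¹) (Or.inr (by positivity)))
    rwa [Real.zero_rpow (by positivity), ENNReal.ofReal_zero] at h1
  · intro Q q h m n hmn
    have hd : DependsBelow n (fun x => IsUrn.ratio Q n x - IsUrn.ratio Q m x) := by
      intro x y hxy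
      simp only
      rw [h.dep_ratio n x y hxy, (h.dep_ratio m).mono hmn x y hxy]
    have hpN : ENNReal.ofReal p ≤ (N : ENNReal) := by
      rw [← ENNReal.ofReal_natCast]
      refine ENNReal.ofReal_le_ofReal (hk.trans ?_)
      rw [hN]
      push_cast
      linarith [(Nat.cast_nonneg k : (0 : ℝ) ≤ k)]
    refine (eLpNorm_le_eLpNorm_of_exponent_le hpN
      (hd.measurable' he.measurable).aestronglyMeasurable).trans ?_
    rw [(hd.memLp he.measurable (N : ENNReal)).eLpNorm_eq_integral_rpow_norm
      (by rw [hN]; simp) (ENNReal.natCast_ne_top N)]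
    have heven : Even N := ⟨k + 2, by omega⟩
    simp only [ENNReal.toReal_natCast, Real.rpow_natCast, Real.norm_eq_abs, heven.pow_abs]
    refine ENNReal.ofReal_le_ofReal (Real.rpow_le_rpow (integral_nonneg fun ω => heven.pow_nonneg _)
      (hbound he h hmn) (by positivity))

theorem IsUrn.ae_exists_tendsto (he : IsRRTProcess e P) {Q : ℕ → Encoding → ℝ}
    {q : ℕ → ℕ → Encoding → ℝ} (h : IsUrn Q q) (h0 : ∀ x, Q 0 x = 0) :
    ∀ᵐ ω ∂P, ∃ c, Tendsto (fun n => ratio Q n (enc e ω)) atTop (𝓝 c) := by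
  obtain ⟨ε, -, hε, hbound⟩ := exists_eLpNorm_bound he 1
  have hsub := submartingale_ratio he Q q h.dep_total h.dep (fun n x => (h.step n x).ge)
    fun n x => (h.sum n x).le
  refine hsub.exists_ae_tendsto_of_bdd (R := (ε 0).toNNReal) fun n => ?_
  rw [ENNReal.coe_toNNReal (hε 0)]
  have h1 := hbound h (Nat.zero_le n)
  simp only [ratio, h0, zero_div, sub_zero, ENNReal.ofReal_one] at h1
  exact h1

theorem IsUrn.integral_eq_zero (he : IsRRTProcess e P) {Q : ℕ → Encoding → ℝ}
    {q : ℕ → ℕ → Encoding → ℝ} (h : IsUrn Q q) (h0 : ∀ x, Q 0 x = 0) (n : ℕ) :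
    ∫ ω, Q n (enc e ω) ∂P = 0 := by
  induction n with
  | zero => simp [h0]
  | succ n ih =>
    have h1 : ∀ ω, Q (n + 1) (enc e ω) = Q n (enc e ω) + q n (e n ω) (enc e ω) := fun ω =>
      h.step n (enc e ω)
    simp only [h1]
    rw [integral_add_step he n (h.dep_total n) (h.dep n) (h.sum n), ih, mul_zero]

/-- The limit of a truncatable urn functional is the series of the limits of its tolls. -/
theorem exists_limit_series (he : IsRRTProcess e P) {S : ℕ → ℕ → Encoding → ℝ}
    {q : ℕ → ℕ → ℕ → Encoding → ℝ} {toll : ℕ → Node → Encoding → ℝ}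
    (hurn : ∀ k, IsUrn (S k) (q k)) (h0 : ∀ x, S 0 0 x = 0)
    (hzero : ∀ {k n : ℕ}, n < k → ∀ x, S k n x = 0)
    (hsub : ∀ k n x, S 0 n x - S (k + 1) n x = ∑ u ∈ nodesUpTo k, toll n u x)
    {T : Ω → Node → ℝ}
    (hT : ∀ᵐ ω ∂P, ∀ u, Tendsto (fun n : ℕ => toll n u (enc e ω) / ((n : ℝ) + 1)) atTop
      (𝓝 (T ω u))) :
    ∃ Y : Ω → ℝ, (∀ p : ℝ, 0 < p →
        TendstoInLp (fun k ω => ∑ u ∈ nodesUpTo k, T ω u) Y p P) ∧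
      (∀ᵐ ω ∂P, Tendsto (fun n => IsUrn.ratio (S 0) n (enc e ω)) atTop (𝓝 (Y ω))) ∧
      ∀ p : ℝ, 0 < p → TendstoInLp (fun n ω => IsUrn.ratio (S 0) n (enc e ω)) Y p P := by
  have hex : ∀ ω, ∃ c, (∃ c, Tendsto (fun n => IsUrn.ratio (S 0) n (enc e ω)) atTop (𝓝 c)) →
      Tendsto (fun n => IsUrn.ratio (S 0) n (enc e ω)) atTop (𝓝 c) := by
    intro ω
    by_cases h : ∃ c, Tendsto (fun n => IsUrn.ratio (S 0) n (enc e ω)) atTop (𝓝 c)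
    · obtain ⟨c, hc⟩ := h
      exact ⟨c, fun _ => hc⟩
    · exact ⟨0, fun h' => absurd h' h⟩
  choose Y hY using hex
  have hYlim : ∀ᵐ ω ∂P, Tendsto (fun n => IsUrn.ratio (S 0) n (enc e ω)) atTop (𝓝 (Y ω)) := by
    filter_upwards [(hurn 0).ae_exists_tendsto he h0] with ω hω
    exact hY ω hω
  have hRm : ∀ k n, AEStronglyMeasurable (fun ω => IsUrn.ratio (S k) n (enc e ω)) P := fun k n =>
    (((hurn k).dep_ratio n).measurable' he.measurable).aestronglyMeasurable
  have hYm : AEStronglyMeasurable Y P := aestronglyMeasurable_of_tendsto_ae atTop (hRm 0) hYlim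
  have hratio0 : ∀ x, IsUrn.ratio (S 0) 0 x = 0 := fun x => by rw [IsUrn.ratio, h0, zero_div]
  -- Let `n → ∞` in the moment bound at fixed `m`, by Fatou.
  have hYdiff : ∀ p (ε : ℕ → ENNReal), (∀ {Q : ℕ → Encoding → ℝ} {q : ℕ → ℕ → Encoding → ℝ},
      IsUrn Q q → ∀ {m n : ℕ}, m ≤ n →
        eLpNorm (fun ω => IsUrn.ratio Q n (enc e ω) - IsUrn.ratio Q m (enc e ω))
          (ENNReal.ofReal p) P ≤ ε m) → ∀ m,
      eLpNorm ((fun ω => IsUrn.ratio (S 0) m (enc e ω)) - Y) (ENNReal.ofReal p) P ≤ ε m := by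
    intro p ε hε m
    rw [eLpNorm_sub_comm]
    refine eLpNorm_le_of_ae_tendsto
      (f := fun n ω => IsUrn.ratio (S 0) n (enc e ω) - IsUrn.ratio (S 0) m (enc e ω))
      (fun n => (hRm 0 n).sub (hRm 0 m)) ?_ ?_
    · filter_upwards [eventually_ge_atTop m] with n hn
      exact hε (hurn 0) hn
    · filter_upwards [hYlim] with ω hω
      exact hω.sub_const _
  have hYmem : ∀ p : ℝ, MemLp Y (ENNReal.ofReal p) P := by
    intro p
    obtain ⟨ε, -, hεtop, hε⟩ := exists_eLpNorm_bound he p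
    refine ⟨hYm, lt_of_le_of_lt ?_ (hεtop 0).lt_top⟩
    have h1 := hYdiff p ε hε 0
    have h2 : ((fun ω => IsUrn.ratio (S 0) 0 (enc e ω)) - Y) = -Y := by
      funext ω
      simp [hratio0]
    rwa [h2, eLpNorm_neg] at h1
  refine ⟨Y, fun p hp => ?_, hYlim, fun p hp => ?_⟩
  · obtain ⟨ε, hε0, hεtop, hε⟩ := exists_eLpNorm_bound he p
    -- The error of the `k`-th partial sum is minus the limit of the functional cut at level `k +
    -- 1`.
    have hlim : ∀ k, ∀ᵐ ω ∂P, Tendsto (fun n => -IsUrn.ratio (S (k + 1)) n (enc e ω)) atTop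
        (𝓝 (((fun ω => ∑ u ∈ nodesUpTo k, T ω u) - Y) ω)) := by
      intro k
      filter_upwards [hT, hYlim] with ω hω1 hω2
      have h1 := (tendsto_finsetSum (nodesUpTo k) fun u _ => hω1 u).sub hω2
      refine h1.congr fun n => ?_
      rw [← Finset.sum_div, ← hsub]
      unfold IsUrn.ratio
      ring
    have hdiff : ∀ k, eLpNorm ((fun ω => ∑ u ∈ nodesUpTo k, T ω u) - Y) (ENNReal.ofReal p) P ≤
        ε k := by
      intro k
      refine eLpNorm_le_of_ae_tendsto (f := fun n ω => -IsUrn.ratio (S (k + 1)) n (enc e ω))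
        (fun n => (hRm (k + 1) n).neg) ?_ (hlim k)
      filter_upwards [eventually_ge_atTop k] with n hn
      have h1 := hε (hurn (k + 1)) hn
      -- The functional cut at level `k + 1` is still zero at time `k`, so the increment bound from
      -- time `k` controls its whole norm by `ε k`.
      have h2 : ∀ x, IsUrn.ratio (S (k + 1)) k x = 0 := fun x => by
        rw [IsUrn.ratio, hzero (Nat.lt_succ_self k), zero_div]
      simp only [h2, sub_zero] at h1
      refine le_trans (le_of_eq ?_) h1
      exact eLpNorm_neg (fun ω => IsUrn.ratio (S (k + 1)) n (enc e ω)) _ _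
    refine ⟨fun k => ?_, hYmem p, tendsto_of_tendsto_of_tendsto_of_le_of_le tendsto_const_nhds hε0
      (fun _ => zero_le) hdiff⟩
    have h1 : MemLp ((fun ω => ∑ u ∈ nodesUpTo k, T ω u) - Y) (ENNReal.ofReal p) P :=
      ⟨aestronglyMeasurable_of_tendsto_ae atTop (fun n => (hRm (k + 1) n).neg) (hlim k),
        (hdiff k).trans_lt (hεtop k).lt_top⟩
    simpa using h1.add (hYmem p)
  · obtain ⟨ε, hε0, -, hε⟩ := exists_eLpNorm_bound he p
    exact ⟨fun n => ((hurn 0).dep_ratio n).memLp he.measurable _, hYmem p,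
      tendsto_of_tendsto_of_tendsto_of_le_of_le tendsto_const_nhds hε0
        (fun _ => zero_le) (hYdiff p ε hε)⟩

/-! ### Identification of the toll limits, and the mean. -/

theorem ae_isGood (he : IsRRTProcess e P) {Xinf : Ω → ProbabilityMeasure NodeBar}
    (hX : IsDoobMartinLimit (harrisChain e) Xinf P) :
    ∀ᵐ ω ∂P, IsGood (enc e ω) (mass (Xinf ω)) := by
  filter_upwards [hX.tendsto, ae_exists_childSum_le he, ae_exists_pos_le_cnt he] with ω h1 h2 h3
  have h4 : ∀ u, Tendsto (fun n : ℕ => (cnt (enc e ω) n u : ℝ) / (n + 1)) atTop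
      (𝓝 (mass (Xinf ω) u)) := fun u => (tendsto_harrisChain_iff e ω u _).1 (h1 u)
  refine ⟨h4, fun u => ?_, h2⟩
  obtain ⟨δ, hδ, h5⟩ := h3 u
  exact hδ.trans_le (ge_of_tendsto (h4 u) h5)

theorem IsGood.isRegular {x : Encoding} {μ : ProbabilityMeasure NodeBar}
    (h : IsGood x (mass μ)) : IsRegular μ where
  mass_pos := h.pos
  hasSum_rho u := by
    have h1 := (h.hasSum_children u).div_const (mass μ u)
    rwa [div_self (h.pos u).ne'] at h1
  summable_C u := by
    refine ((h.summable_log u).div_const (mass μ u)).congr fun i => ?_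
    simp only [rho]
    ring
  summable_D u := by
    refine ((h.summable_id_mul u).div_const (mass μ u)).congr fun i => ?_
    simp only [rho]
    ring

theorem IsGood.mass_mul_C {x : Encoding} {μ : ProbabilityMeasure NodeBar}
    (h : IsGood x (mass μ)) (u : Node) :
    mass μ u * C (rho μ u) = mass μ u +
      ∑' i : ℕ+, mass μ (u ++ [i]) * Real.log (mass μ (u ++ [i]) / mass μ u) := by
  have h0 := (h.pos u).ne'
  rw [C, mul_add, mul_one, ← tsum_mul_left]
  congr 1
  refine tsum_congr fun i => ?_
  rw [rho]
  field_simp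

theorem IsGood.mass_mul_D {x : Encoding} {μ : ProbabilityMeasure NodeBar}
    (h : IsGood x (mass μ)) (u : Node) :
    mass μ u * D (rho μ u) = ∑' i : ℕ+, mass μ (u ++ [i]) * ((i : ℝ) - 2) := by
  have h0 := (h.pos u).ne'
  have h1 : ∀ i : ℕ+, mass μ (u ++ [i]) * ((i : ℝ) - 2) =
      (i : ℝ) * mass μ (u ++ [i]) - mass μ (u ++ [i]) * 2 := fun i => by ring
  rw [tsum_congr h1, (h.summable_id_mul u).tsum_sub ((h.hasSum_children u).summable.mul_right 2),
    tsum_mul_right, (h.hasSum_children u).tsum_eq, D, mul_add, ← tsum_mul_left, add_comm,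
    mul_neg, ← sub_eq_add_neg]
  congr 1
  refine tsum_congr fun i => ?_
  rw [rho]
  field_simp

theorem dependsBelow_HPL (n : ℕ) : DependsBelow n (fun x => HPL (harrisTree x n)) := by
  intro x y h
  simp only [HPL, sum_harrisTree]
  refine Finset.sum_congr rfl fun j hj => ?_
  rw [word_congr h (Finset.mem_range.1 hj).le]

theorem pathSum_zero_zero (x : Encoding) : pathSum 0 0 x = 0 := by
  simp [pathSum, pathInc, exit_zero, cnt_nil, word_zero]

theorem widthSum_zero_zero (x : Encoding) : widthSum 0 0 x = 0 := by
  simp [widthSum, widthInc, exit_zero, word_zero, deg]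

theorem standardized_HPL (n : ℕ) (x : Encoding) :
    1 / ((n + 1 : ℕ) : ℝ) * HPL (harrisTree x (n + 1)) - (harmonic (n + 1) : ℝ) + 2 =
      IsUrn.ratio (pathSum 0) n x + IsUrn.ratio (widthSum 0) n x + 1 / ((n : ℝ) + 1) := by
  rw [HPL_harrisTree, IsUrn.ratio, IsUrn.ratio]
  push_cast
  field_simp
  ring

theorem integral_HPL (he : IsRRTProcess e P) (n : ℕ) :
    ∫ ω, HPL (harrisChain e (n + 1) ω) ∂P =
      ((n : ℝ) + 1) * harmonic (n + 1) - 2 * (n + 1) + 1 := by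
  have h1 : ∀ ω, HPL (harrisChain e (n + 1) ω) =
      (pathSum 0 n (enc e ω) + widthSum 0 n (enc e ω)) +
        (((n : ℝ) + 1) * harmonic (n + 1) - 2 * (n + 1) + 1) := by
    intro ω
    change HPL (harrisTree (enc e ω) (n + 1)) = _
    rw [HPL_harrisTree]
    ring
  have hi1 := ((isUrn_pathSum 0).dep_total n).integrable (P := P) he.measurable
  have hi2 := ((isUrn_widthSum 0).dep_total n).integrable (P := P) he.measurable
  have hi : Integrable (fun ω => pathSum 0 n (enc e ω) + widthSum 0 n (enc e ω)) P := hi1.add hi2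
  simp only [h1]
  rw [integral_add hi (integrable_const _), integral_add hi1 hi2,
    (isUrn_pathSum 0).integral_eq_zero he pathSum_zero_zero,
    (isUrn_widthSum 0).integral_eq_zero he widthSum_zero_zero, integral_const, probReal_univ]
  simp

end

end RRT

theorem theorem7 {Ω : Type*} [MeasurableSpace Ω] (P : Measure Ω) [IsProbabilityMeasure P]
    (e : (k : ℕ) → Ω → Fin (k + 1)) (he : RRT.IsRRTProcess e P) :
    -- the limit tree exists
    (∃ Xinf : Ω → ProbabilityMeasure RRT.NodeBar,
      RRT.IsDoobMartinLimit (RRT.harrisChain e) Xinf P) ∧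
    -- convergence of the standardized horizontal total path length
    (∀ Xinf : Ω → ProbabilityMeasure RRT.NodeBar,
      RRT.IsDoobMartinLimit (RRT.harrisChain e) Xinf P →
        (∀ᵐ ω ∂P, RRT.IsRegular (Xinf ω)) ∧
        ∃ Y Z : Ω → ℝ,
          RRT.IsNodeSeries RRT.C Xinf Y P ∧
          RRT.IsNodeSeries RRT.D Xinf Z P ∧
          (∀ᵐ ω ∂P, Tendsto
            (fun n : ℕ => 1 / (n : ℝ) * RRT.HPL (RRT.harrisChain e n ω) - (harmonic n : ℝ) + 2)
            atTop (𝓝 (Y ω + Z ω))) ∧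
          (∀ p : ℝ, 0 < p → RRT.TendstoInLp
            (fun n ω => 1 / (n : ℝ) * RRT.HPL (RRT.harrisChain e n ω) - (harmonic n : ℝ) + 2)
            (fun ω => Y ω + Z ω) p P)) ∧
    -- the mean
    (∀ n : ℕ, 1 ≤ n →
      Integrable (fun ω => RRT.HPL (RRT.harrisChain e n ω)) P ∧
      ∫ ω, RRT.HPL (RRT.harrisChain e n ω) ∂P = (n : ℝ) * (harmonic n : ℝ) - 2 * (n : ℝ) + 1) := by
  refine ⟨RRT.exists_isDoobMartinLimit he, fun Xinf hX => ?_, fun n hn => ?_⟩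
  · have hgood := RRT.ae_isGood he hX
    refine ⟨hgood.mono fun ω h => h.isRegular, ?_⟩
    obtain ⟨Y, hY1, hY2, hY3⟩ := RRT.exists_limit_series he RRT.isUrn_pathSum
      RRT.pathSum_zero_zero RRT.pathSum_eq_zero RRT.pathSum_zero_sub
      (T := fun ω u => RRT.mass (Xinf ω) u * RRT.C (RRT.rho (Xinf ω) u))
      (hgood.mono fun ω h u => by
        rw [h.mass_mul_C]
        exact h.tendsto_pathToll u)
    obtain ⟨Z, hZ1, hZ2, hZ3⟩ := RRT.exists_limit_series he RRT.isUrn_widthSum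
      RRT.widthSum_zero_zero RRT.widthSum_eq_zero RRT.widthSum_zero_sub
      (T := fun ω u => RRT.mass (Xinf ω) u * RRT.D (RRT.rho (Xinf ω) u))
      (hgood.mono fun ω h u => by
        rw [h.mass_mul_D]
        exact h.tendsto_widthToll u)
    have hstd : ∀ n ω, 1 / ((n + 1 : ℕ) : ℝ) * RRT.HPL (RRT.harrisChain e (n + 1) ω) -
        (harmonic (n + 1) : ℝ) + 2 = RRT.IsUrn.ratio (RRT.pathSum 0) n (RRT.enc e ω) +
          RRT.IsUrn.ratio (RRT.widthSum 0) n (RRT.enc e ω) + 1 / ((n : ℝ) + 1) := fun n ω =>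
      RRT.standardized_HPL n (RRT.enc e ω)
    refine ⟨Y, Z, hY1, hZ1, ?_, fun p hp => ?_⟩
    · filter_upwards [hY2, hZ2] with ω h1 h2
      rw [← tendsto_add_atTop_iff_nat 1]
      simp only [hstd]
      have h3 := (h1.add h2).add (tendsto_one_div_add_atTop_nhds_zero_nat (𝕜 := ℝ))
      rwa [add_zero] at h3
    -- The triangle inequality used for the three summands needs an exponent at least 1; smaller
    -- exponents follow from larger ones.
    · refine RRT.TendstoInLp.mono_exponent (le_max_left p 1) ?_
      have hp1 : 1 ≤ max p 1 := le_max_right p 1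
      have hp0 : 0 < max p 1 := zero_lt_one.trans_le hp1
      have h1 := ((hY3 _ hp0).add hp1 (hZ3 _ hp0)).add hp1
        (RRT.tendstoInLp_const (tendsto_one_div_add_atTop_nhds_zero_nat (𝕜 := ℝ)) hp0)
      have hlim : (Y + Z + fun _ => (0 : ℝ)) = fun ω => Y ω + Z ω := by
        funext ω
        simp
      rw [hlim] at h1
      refine ⟨fun n => ?_, h1.memLp_limit, ?_⟩
      -- Membership is checked directly for every `n`, because the shifted identity `hstd` does not
      -- cover the empty tree `n = 0`.
      · exact ((RRT.dependsBelow_HPL n).comp fun y =>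
          1 / (n : ℝ) * y - (harmonic n : ℝ) + 2).memLp he.measurable _
      · rw [← tendsto_add_atTop_iff_nat 1]
        simp only [hstd]
        exact h1.tendsto
  · obtain ⟨n, rfl⟩ := Nat.exists_eq_add_of_le' hn
    refine ⟨(RRT.dependsBelow_HPL (n + 1)).integrable he.measurable, ?_⟩
    rw [RRT.integral_HPL he n]
    push_cast
    ring
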